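/- **Setting.** Let $M$ be a deterministic contextual MDP with horizon $H$, (discrete) state space $\mathcal S$ split into layers $\mathcal S_1,\dots,\mathcal S_H$, action space $\mathcal A$, initial distribution $\rho$ on $\mathcal S_1$, deterministic transitions from $\mathcal S_h\times\mathcal A$ to $\mathcal S_{h+1}$, and reward $r:\mathcal S\times\mathcal A\to\mathbb R$. A policy is a map $\pi:\mathcal S\to\Delta(\mathcal A)$; for a trajectory $\tau=(s_1,a_1),\dots,(s_H,a_H)$ write $\pi(\tau)=\prod_h\pi(a_h\mid s_h)$ and $r(\tau)=\sum_h r(s_h,a_h)$. "Trajectory" means one that can be generated in $M$, and $r(\tau)\in[0,R_{\max}]$ for all trajectories, $R_{\max}>0$. Fix a reference policy $\pi_{\mathrm{ref}}$ and $\beta>0$, and let $$J_\beta(\pi)=\mathbb E_\pi\Big[r(\tau)-\beta\log\tfrac{\pi(\tau)}{\pi_{\mathrm{ref}}(\tau)}\Big],\qquad \pi^\star_\beta\in\operatorname*{argmax}_{\pi}J_\beta(\pi)\ \text{ over all policies } \pi.$$ Let $\Pi$ be a finite class of policies with $\pi^\star_\beta\in\Pi$, such that for all $\pi\in\Pi$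 and all trajectories $\tau$, $\pi(\tau),\pi_{\mathrm{ref}}(\tau)>0$ and $|\log(\pi(\tau)/\pi_{\mathrm{ref}}(\tau))|\le V_{\max}/\beta$. Assume $V_{\max}+R_{\max}\ge1$. **Algorithm (XPO with a general sampling strategy).** A sampling strategy $\boldsymbol\pi_{\mathrm{samp}}$ maps every finite list of policies to a policy, or more generally to a mixture of policies (a random policy drawn at the start of the episode). Given $T\ge1$ and $\alpha$, put $\pi^{(1)}=\tilde\pi^{(1)}=\pi_{\mathrm{ref}}$. In iteration $t=1,\dots,T$: draw $s_1^{(t)}\sim\rho$, $\tau^{(t)}\sim\pi^{(t)}\mid s_1^{(t)}$, $\tilde\tau^{(t)}\sim\tilde\pi^{(t)}\mid s^{(t)}_1$; label the pair as $(\tau_+^{(t)},\tau_-^{(t)})$ by the Bradley–Terry model, i.e. $\tau_+^{(t)}=\tau^{(t)}$ with probability $e^{r(\tau^{(t)})}/(e^{r(\tau^{(t)})}+e^{r(\tilde\tau^{(t)})})$; draw a fresh set $\mathcal D^{(t)}_{\mathrm{opt}}$ of $t$ i.i.d. trajectories from $\tilde\pi^{(t)}$ (with initial states from $\rho$); let $$\pi^{(t+1)}\in\operatorname*{argmin}_{\pi\in\Pi}\Big\{\alpha\sum_{\tau\in\mathcal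 D^{(t)}_{\mathrm{opt}}}\log\pi(\tau)-\sum_{i\le t}\log\sigma\Big(\beta\log\tfrac{\pi(\tau^{(i)}_+)}{\pi_{\mathrm{ref}}(\tau^{(i)}_+)}-\beta\log\tfrac{\pi(\tau^{(i)}_-)}{\pi_{\mathrm{ref}}(\tau^{(i)}_-)}\Big)\Big\},\qquad \sigma(x)=\frac{e^x}{1+e^x},$$ with ties broken arbitrarily, and $\tilde\pi^{(t+1)}=\boldsymbol\pi_{\mathrm{samp}}(\pi^{(1)},\dots,\pi^{(t+1)})$. Return $\hat\pi\in\operatorname{argmax}_{\pi\in\{\pi^{(1)},\dots,\pi^{(T+1)}\}}J_\beta(\pi)$. *Plain XPO* is the same algorithm with $\tilde\pi^{(t)}=\pi_{\mathrm{ref}}$ for all $t$ and $\mathcal D_{\mathrm{opt}}^{(t)}=\{\tilde\tau^{(1)},\dots,\tilde\tau^{(t)}\}$. **Sequential Extrapolation Coefficient.** With $\delta_\pi(\tau,\tilde\tau)=\beta\log\frac{\pi(\tau)}{\pi_{\mathrm{ref}}(\tau)}-r(\tau)-\beta\log\frac{\pi(\tilde\tau)}{\pi_{\mathrm{ref}}(\tilde\tau)}+r(\tilde\tau)$,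 $$\mathrm{SEC}(\Pi,T,\beta;\boldsymbol\pi_{\mathrm{samp}})=\sup_{\pi^{(1)},\dots,\pi^{(T)}\in\Pi}\ \sum_{t=1}^T\frac{\big(\mathbb E_{s_1\sim\rho,\ \tau\sim\pi^{(t)}\mid s_1,\ \tilde\tau\sim\tilde\pi^{(t-1)}\mid s_1}[\delta_{\pi^{(t)}}(\tau,\tilde\tau)]\big)^2}{V_{\max}^2\vee\sum_{i<t}\mathbb E_{s_1\sim\rho,\ \tau\sim\pi^{(i)}\mid s_1,\ \tilde\tau\sim\tilde\pi^{(i)}\mid s_1}[\delta_{\pi^{(t)}}(\tau,\tilde\tau)^2]},$$ where $\tilde\pi^{(t)}=\boldsymbol\pi_{\mathrm{samp}}(\pi^{(1)},\dots,\pi^{(t)})$, and $\tilde\pi^{(0)}$ is the value of $\boldsymbol\pi_{\mathrm{samp}}$ at the empty list. Write $\mathrm{SEC}(\Pi,T,\beta;\pi_{\mathrm{ref}})$ for the strategy that is constantly $\pi_{\mathrm{ref}}$. **Theorem.** For every constant $c>0$ there is a constant $C>0$ depending only on $c$ such that, for every instance as above, every $T\ge1$ and every $\delta\in(0,1)$: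 1. If $\pi_{\mathrm{ref}}\in\Pi$ and $\mathrm{SEC}:=\mathrm{SEC}(\Pi,T,\beta;\boldsymbol\pi_{\mathrm{samp}})>0$, then XPO with sampling strategy $\boldsymbol\pi_{\mathrm{samp}}$ and $$\alpha=c\cdot\frac{\beta}{(V_{\max}+R_{\max})e^{2R_{\max}}}\sqrt{\frac{\log(|\Pi|T\delta^{-1})\log T}{T\cdot\mathrm{SEC}}}$$ satisfies, with probability at least $1-\delta$, $$J_\beta(\pi^\star_\beta)-J_\beta(\hat\pi)\le C\,(V_{\max}+R_{\max})e^{2R_{\max}}\sqrt{\frac{\max\{\mathrm{SEC}\cdot\log T,\,1\}\,\log(|\Pi|T\delta^{-1})}{T}};$$ in particular the right-hand side is $C(V_{\max}+R_{\max})e^{2R_{\max}}\sqrt{\mathrm{SEC}\,\log(|\Pi|T\delta^{-1})\log T/T}$ whenever $\mathrm{SEC}\cdot\log T\ge1$. 2. If $\mathrm{SEC}:=\mathrm{SEC}(\Pi,T,\beta;\pi_{\mathrm{ref}})>0$, then plain XPO with $\alpha$ given by the same formula satisfies the same bound with probability at least $1-\delta$ (here $\pi_{\mathrm{ref}}\in\Pi$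 is not needed). -/

import Mathlib

open scoped ENNReal NNReal

noncomputable section

namespace XPO

/-- A randomized policy `π : 𝒮 → Δ(𝒜)`. -/
abbrev Policy (S A : Type*) := S → PMF A

/-- A mixed policy: a policy is drawn once at the start of the episode and then followed.
An ordinary policy `π` is `PMF.pure π`; the uniform mixture `unif(π₁, …, πₜ)` is another example. -/
abbrev MixedPolicy (S A : Type*) := PMF (Policy S A)

/-- A sampling strategy maps `(π₁, …, πₜ)` to the sampling policy `π̃ₜ`. -/
abbrev Strategy (S A : Type*) := List (Policy S A) → MixedPolicy S A

/-- Trajectories `(s₁, a₁), …, (s_H, a_H)`. -/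
abbrev Traj (S A : Type*) := List (S × A)

/-- Expectation of a real-valued function under a discrete distribution. -/
def expect {X : Type*} (p : PMF X) (f : X → ℝ) : ℝ := ∑' x, (p x).toReal * f x

/-- `n` independent samples from `p`. -/
def iid {X : Type*} (p : PMF X) : ℕ → PMF (List X)
  | 0 => PMF.pure []
  | n + 1 => p.bind fun x => (iid p n).map fun l => x :: l

/-- `π(τ) = ∏ₕ π(aₕ ∣ sₕ)`. -/
def polProb {S A : Type*} (π : Policy S A) (τ : Traj S A) : ℝ :=
  (τ.map fun x => (π x.1 x.2).toReal).prod

/-- `log (π(τ) / π_ref(τ))`. -/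
def logRatio {S A : Type*} (π πref : Policy S A) (τ : Traj S A) : ℝ :=
  Real.log (polProb π τ / polProb πref τ)

/-- A deterministic contextual MDP of horizon `H`: random initial state, deterministic transitions,
and a state space split into layers `0, …, H - 1` (the layer is the time step, counted from `0`).
The value of `next` on the last layer is irrelevant. -/
structure DCMDP (S A : Type*) (H : ℕ) where
  init : PMF S
  next : S → A → S
  reward : S → A → ℝ
  layer : S → Fin H
  layer_init : ∀ s ∈ init.support, (layer s : ℕ) = 0
  layer_next : ∀ s a, (layer s : ℕ) + 1 < H → (layer (next s a) : ℕ) = (layer s : ℕ) + 1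

namespace DCMDP

variable {S A : Type*} {H : ℕ} (M : DCMDP S A H)

/-- The trajectory obtained from state `s` by playing a given list of actions. -/
def path : S → List A → Traj S A
  | _, [] => []
  | s, a :: as => (s, a) :: path (M.next s a) as

/-- Admissible trajectories: those that some policy can generate. -/
def Admissible (τ : Traj S A) : Prop :=
  ∃ s ∈ M.init.support, ∃ as : List A, as.length = H ∧ τ = M.path s as

/-- `r(τ) = ∑ₕ r(sₕ, aₕ)`. -/
def ret (τ : Traj S A) : ℝ := (τ.map fun x => M.reward x.1 x.2).sum

/-- Law of the next `n` state-action pairs from state `s` under `π`. -/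
def rollout (π : Policy S A) : ℕ → S → PMF (Traj S A)
  | 0, _ => PMF.pure []
  | n + 1, s => (π s).bind fun a => (rollout π n (M.next s a)).map fun τ => (s, a) :: τ

/-- Law of `τ ∼ π̃ ∣ s₁` for a mixed policy. -/
def response (ν : MixedPolicy S A) (s : S) : PMF (Traj S A) :=
  ν.bind fun π => M.rollout π H s

/-- Law of `τ` when `s₁ ∼ ρ`, `τ ∼ π̃ ∣ s₁`. -/
def trajLaw (ν : MixedPolicy S A) : PMF (Traj S A) :=
  M.init.bind fun s => M.response ν s

/-- Law of `(τ, τ̃)` when `s₁ ∼ ρ`, and then `τ ∼ π ∣ s₁` and `τ̃ ∼ π̃ ∣ s₁` independently. -/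
def pairLaw (π : Policy S A) (ν : MixedPolicy S A) : PMF (Traj S A × Traj S A) :=
  M.init.bind fun s => (M.rollout π H s).bind fun τ => (M.response ν s).map fun τ' => (τ, τ')

/-- The integrand `r(τ) - β log (π(τ) / π_ref(τ))` of the KL-regularized objective. -/
def klReward (πref : Policy S A) (β : ℝ) (π : Policy S A) (τ : Traj S A) : ℝ :=
  M.ret τ - β * logRatio π πref τ

/-- The KL-regularized objective `J_β(π) = 𝔼_π[r(τ) - β log (π(τ) / π_ref(τ))]`. -/
def J (πref : Policy S A) (β : ℝ) (π : Policy S A) : ℝ :=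
  expect (M.trajLaw (PMF.pure π)) (M.klReward πref β π)

/-- The expectation defining `J_β(π)` is finite (for bounded returns and `π_ref` of full support
it can otherwise only be `-∞`). -/
def FiniteJ (πref : Policy S A) (β : ℝ) (π : Policy S A) : Prop :=
  Summable fun τ => (M.trajLaw (PMF.pure π) τ).toReal * M.klReward πref β π τ

/-- `π ∈ argmax J_β` over all policies; policies with `J_β = -∞` impose no constraint. -/
def IsOptimal (πref : Policy S A) (β : ℝ) (π : Policy S A) : Prop :=
  M.FiniteJ πref β π ∧ ∀ π', M.FiniteJ πref β π' → M.J πref β π' ≤ M.J πref β π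

/-- The total reward of a trajectory always lies in `[0, R_max]`. -/
def BoundedReturn (R : ℝ) : Prop := ∀ τ, M.Admissible τ → M.ret τ ∈ Set.Icc 0 R

/-- Bounded density ratios: `|log (π(τ) / π_ref(τ))| ≤ V_max / β` for every `π ∈ Π` and every
trajectory; positivity says that the logarithm is finite. -/
def BoundedRatio (πref : Policy S A) (Pol : Finset (Policy S A)) (β V : ℝ) : Prop :=
  ∀ π ∈ Pol, ∀ τ, M.Admissible τ →
    0 < polProb πref τ ∧ 0 < polProb π τ ∧ |logRatio π πref τ| ≤ V / β

/-! ### The Sequential Extrapolation Coefficient -/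

/-- `β log (π(τ)/π_ref(τ)) - r(τ) - β log (π(τ̃)/π_ref(τ̃)) + r(τ̃)`. -/
def discrepancy (πref : Policy S A) (β : ℝ) (π : Policy S A) (x : Traj S A × Traj S A) : ℝ :=
  β * logRatio π πref x.1 - M.ret x.1 - β * logRatio π πref x.2 + M.ret x.2

/-- `π̃ₜ = π_samp(π₁, …, πₜ)` for a sequence of policies indexed from `1`. -/
def tilde (samp : Strategy S A) (p : ℕ → Policy S A) (t : ℕ) : MixedPolicy S A :=
  samp ((List.range t).map fun i => p (i + 1))

/-- Expectation under `μₜ = (t-1)⁻¹ ∑_{i<t} πᵢ ⊗ π̃ᵢ`. -/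
def muExpect (samp : Strategy S A) (p : ℕ → Policy S A) (t : ℕ)
    (f : Traj S A × Traj S A → ℝ) : ℝ :=
  ((t : ℝ) - 1)⁻¹ * ∑ i ∈ Finset.Ico 1 t, expect (M.pairLaw (p i) (tilde samp p i)) f

/-- The `t`-th summand in the definition of the SEC. -/
def secTerm (πref : Policy S A) (β V : ℝ) (samp : Strategy S A) (p : ℕ → Policy S A)
    (t : ℕ) : ℝ :=
  (expect (M.pairLaw (p t) (tilde samp p (t - 1))) (M.discrepancy πref β (p t))) ^ 2 /
    max (V ^ 2)
      (((t : ℝ) - 1) * M.muExpect samp p t fun x => (M.discrepancy πref β (p t) x) ^ 2)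

/-- `SEC(Π, T, β; π_samp)`. -/
def SEC (πref : Policy S A) (Pol : Finset (Policy S A)) (T : ℕ) (β V : ℝ)
    (samp : Strategy S A) : ℝ :=
  ⨆ p : {p : ℕ → Policy S A // ∀ t, p t ∈ Pol},
    ∑ t ∈ Finset.Icc 1 T, M.secTerm πref β V samp p.1 t

/-! ### The algorithm -/

/-- The Bradley–Terry preference: `true`, meaning `τ ≻ τ̃`, has probability
`exp(r(τ)) / (exp(r(τ)) + exp(r(τ̃)))`, and `false` has the complementary probability
`exp(r(τ̃)) / (exp(r(τ)) + exp(r(τ̃)))`. -/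
def preference (τ τ' : Traj S A) : PMF Bool :=
  PMF.ofFintype
    (fun y => ENNReal.ofReal
      (Real.exp (M.ret (if y then τ else τ')) / (Real.exp (M.ret τ) + Real.exp (M.ret τ'))))
    (by
      have h : 0 < Real.exp (M.ret τ) + Real.exp (M.ret τ') := by positivity
      rw [Fintype.sum_bool, ← ENNReal.ofReal_add (by positivity) (by positivity), ← add_div]
      simp [div_self h.ne'])

end DCMDP

section Algorithm

variable {S A : Type*} {H : ℕ}

/-- The optimistic DPO objective
`α ∑_{τ ∈ D_opt} log π(τ) - ∑_{(τ₊, τ₋) ∈ D_pref} log σ(β log (π(τ₊)/π_ref(τ₊)) - β log (π(τ₋)/π_ref(τ₋)))`. -/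
def objective (πref : Policy S A) (β α : ℝ) (prefs : List (Traj S A × Traj S A))
    (opt : List (Traj S A)) (π : Policy S A) : ℝ :=
  α * (opt.map fun τ => Real.log (polProb π τ)).sum -
    (prefs.map fun x =>
      Real.log (Real.sigmoid (β * logRatio π πref x.1 - β * logRatio π πref x.2))).sum

/-- State of the algorithm at the beginning of iteration `t`. -/
structure State (S A : Type*) where
  /-- `π₁, …, π_{t-1}` -/
  past : List (Policy S A)
  /-- `πₜ` -/
  cur : Policy S A
  /-- the sampling policy `π̃ₜ` -/
  sampler : MixedPolicy S A
  /-- the preference data, as pairs `(τ₊, τ₋)` -/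
  prefs : List (Traj S A × Traj S A)
  /-- the second responses `τ̃₁, …, τ̃_{t-1}` -/
  seconds : List (Traj S A)

/-- `π₁, …, πₜ`. -/
def State.policies (st : State S A) : List (Policy S A) := st.past ++ [st.cur]

/-- A way of computing the minimizer: given the state, the updated preference data and the optimism
data, it returns a policy. Ties may be broken using the whole state. -/
abbrev Selector (S A : Type*) :=
  State S A → List (Traj S A × Traj S A) → List (Traj S A) → Policy S A

/-- The selector always returns a minimizer over `Π` of the optimistic DPO objective. -/
def IsArgmin (πref : Policy S A) (Pol : Finset (Policy S A)) (β α : ℝ)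
    (sel : Selector S A) : Prop :=
  ∀ st prefs opt, sel st prefs opt ∈ Pol ∧
    ∀ π ∈ Pol, objective πref β α prefs opt (sel st prefs opt) ≤ objective πref β α prefs opt π

/-- One iteration. Here `draw π̃ₜ [τ̃₁, …, τ̃ₜ]` is the law of the optimism data. -/
def step (M : DCMDP S A H) (samp : Strategy S A) (sel : Selector S A)
    (draw : MixedPolicy S A → List (Traj S A) → PMF (List (Traj S A)))
    (st : State S A) : PMF (State S A) :=
  M.init.bind fun s =>
  (M.rollout st.cur H s).bind fun τ =>
  (M.response st.sampler s).bind fun τ' =>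
  (M.preference τ τ').bind fun y =>
    let prefs := st.prefs ++ [if y then (τ, τ') else (τ', τ)]
    let seconds := st.seconds ++ [τ']
    (draw st.sampler seconds).map fun opt =>
      let new := sel st prefs opt
      { past := st.policies
        cur := new
        sampler := samp (st.policies ++ [new])
        prefs := prefs
        seconds := seconds }

/-- The state after a given number of iterations, started from `π₁ = π̃₁ = π_ref`. -/
def run (M : DCMDP S A H) (πref : Policy S A) (samp : Strategy S A) (sel : Selector S A)
    (draw : MixedPolicy S A → List (Traj S A) → PMF (List (Traj S A))) : ℕ → PMF (State S A)
  | 0 => PMF.pure ⟨[], πref, PMF.pure πref, [], []⟩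
  | t + 1 => (run M πref samp sel draw t).bind (step M samp sel draw)

/-- The strategy that always samples from `π_ref`. -/
def refStrategy (πref : Policy S A) : Strategy S A := fun _ => PMF.pure πref

/-- XPO with a general sampling strategy: at iteration `t` the optimism data consists of `t` fresh
independent trajectories drawn from `π̃ₜ`. -/
def runGeneral (M : DCMDP S A H) (πref : Policy S A) (samp : Strategy S A) (sel : Selector S A)
    (T : ℕ) : PMF (State S A) :=
  run M πref samp sel (fun ν seconds => iid (M.trajLaw ν) seconds.length) T

/-- Plain XPO: the second response is always drawn from `π_ref`, and the optimism data is
`τ̃₁, …, τ̃ₜ`. -/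
def runXPO (M : DCMDP S A H) (πref : Policy S A) (sel : Selector S A) (T : ℕ) : PMF (State S A) :=
  run M πref (refStrategy πref) sel (fun _ seconds => PMF.pure seconds) T

/-- `π̂ ∈ argmax_{π ∈ {π₁, …, π_{T+1}}} J_β(π)`. -/
def IsOutput (M : DCMDP S A H) (πref : Policy S A) (β : ℝ) (st : State S A)
    (πhat : Policy S A) : Prop :=
  πhat ∈ st.policies ∧ ∀ π ∈ st.policies, M.J πref β π ≤ M.J πref β πhat

end Algorithm

/-- `log (|Π| T δ⁻¹)`. -/
def logTerm (card T : ℕ) (δ : ℝ) : ℝ := Real.log (card * T * δ⁻¹)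

/-- The optimism parameter
`α = c · β / ((V_max + R_max) e^{2 R_max}) · √(log(|Π| T δ⁻¹) log T / (T · SEC))`. -/
def alphaParam (c β V R : ℝ) (card T : ℕ) (δ sec : ℝ) : ℝ :=
  c * (β / ((V + R) * Real.exp (2 * R))) *
    √(logTerm card T δ * Real.log T / (T * sec))

/-- The rate `(V_max + R_max) e^{2 R_max} √(max(SEC · log T, 1) log(|Π| T δ⁻¹) / T)`, which is
`(V_max + R_max) e^{2 R_max} √(SEC · log(|Π| T δ⁻¹) log T / T)` as soon as `SEC · log T ≥ 1`. -/
def rate (V R : ℝ) (card T : ℕ) (δ sec : ℝ) : ℝ :=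
  (V + R) * Real.exp (2 * R) * √(max (sec * Real.log T) 1 * logTerm card T δ / T)

end XPO

end

open scoped ENNReal NNReal

noncomputable section

namespace XPO

/-! ### Expectations under discrete distributions -/

section Expectation

variable {X Y : Type*}

/-! An optimal `πstar` agrees on trajectories with the Gibbs policy, so `β log (πstar/πref) - r`
depends only on the initial state and its discrepancy vanishes (`IsOptimal.discrepancy_eq_zero`).
Deterministic transitions and layers are what let a state-dependent policy realise the Gibbs weights
of whole trajectories. Two consequences follow: `πstar` induces the true Bradley–Terry model, and
for any sampler `ν` the regret of `π` is its mean discrepancy on `(π, ν)` plus the mean of `β log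
(π/πstar)` under `ν` (`J_sub_J_eq`).

The optimism term of the objective controls the second summand. Minimality bounds `α` times the
empirical sum of `log (π/πstar)` by a log-likelihood gap, and two exponential processes of mean at
most one turn this into a statement about means. Half the log-likelihood gap plus the accumulated
squared discrepancy over `infoConst` exponentiates to a supermartingale, by a Hellinger estimate for
one comparison (`eexpect_run_likProcess_le`); Hoeffding's lemma handles the optimism data
(`Concentrates`). Markov's inequality and a union bound over the class and the iterations
(`toOuterMeasure_run_le`) bound the regret of every `p n` by its discrepancy, plus `β/(αn) (4ℓ -
2Q/K)`, plus `4(V+R)√(ℓ/n)`, where `Q` is the in-sample squared discrepancy and `K` is `infoConst`.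

The SEC bounds the squared discrepancy by `t n * (Q + 4(V+R)²)` with `∑ t n ≤ SEC` (`Controlled`).
AM–GM, weighted so that `Q` cancels, leaves terms in `α n t n`, `1/n` and `1/√n`. Averaging over a
constant fraction of the iterations (`gap_le_rate`) and inserting the prescribed `α` gives the rate,
and the output is at least as good as this average. For `T ≤ 2` the reference policy itself is a
sufficient comparator. -/

/-- Expectation of an extended nonnegative function under a discrete distribution. -/
def eexpect (p : PMF X) (f : X → ℝ≥0∞) : ℝ≥0∞ := ∑' x, p x * f x

lemma eexpect_mono {p : PMF X} {f g : X → ℝ≥0∞} (h : ∀ x ∈ p.support, f x ≤ g x) :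
    eexpect p f ≤ eexpect p g := by
  refine ENNReal.tsum_le_tsum fun x => ?_
  by_cases hx : p x = 0
  · simp [hx]
  · gcongr
    exact h x ((p.mem_support_iff x).2 hx)

lemma eexpect_congr {p : PMF X} {f g : X → ℝ≥0∞} (h : ∀ x ∈ p.support, f x = g x) :
    eexpect p f = eexpect p g :=
  le_antisymm (eexpect_mono fun x hx => (h x hx).le) (eexpect_mono fun x hx => (h x hx).ge)

@[simp]
lemma eexpect_const (p : PMF X) (a : ℝ≥0∞) : eexpect p (fun _ => a) = a := by
  rw [eexpect, ENNReal.tsum_mul_right, p.tsum_coe, one_mul]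

lemma eexpect_le_const {p : PMF X} {f : X → ℝ≥0∞} {a : ℝ≥0∞} (h : ∀ x ∈ p.support, f x ≤ a) :
    eexpect p f ≤ a :=
  (eexpect_mono h).trans_eq (eexpect_const p a)

lemma eexpect_add (p : PMF X) (f g : X → ℝ≥0∞) :
    eexpect p (fun x => f x + g x) = eexpect p f + eexpect p g := by
  simp only [eexpect, mul_add, ENNReal.tsum_add]

lemma eexpect_const_mul (p : PMF X) (a : ℝ≥0∞) (f : X → ℝ≥0∞) :
    eexpect p (fun x => a * f x) = a * eexpect p f := by
  simp only [eexpect, mul_left_comm _ a, ENNReal.tsum_mul_left]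

lemma eexpect_sum {ι : Type*} (p : PMF X) (s : Finset ι) (f : ι → X → ℝ≥0∞) :
    eexpect p (fun x => ∑ i ∈ s, f i x) = ∑ i ∈ s, eexpect p (f i) := by
  classical
  induction s using Finset.induction_on with
  | empty => simp
  | insert i s hi ih => simp only [Finset.sum_insert hi, eexpect_add, ih]

@[simp]
lemma eexpect_pure (a : X) (f : X → ℝ≥0∞) : eexpect (PMF.pure a) f = f a := by
  rw [eexpect, tsum_eq_single a]
  · simp
  · intro x hx
    simp [PMF.pure_apply_of_ne _ _ hx]

lemma eexpect_bind (p : PMF X) (q : X → PMF Y) (f : Y → ℝ≥0∞) :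
    eexpect (p.bind q) f = eexpect p fun x => eexpect (q x) f := by
  simp only [eexpect, PMF.bind_apply, ← ENNReal.tsum_mul_right, ← ENNReal.tsum_mul_left]
  rw [ENNReal.tsum_comm]
  simp only [mul_assoc]

lemma eexpect_map (p : PMF X) (g : X → Y) (f : Y → ℝ≥0∞) :
    eexpect (p.map g) f = eexpect p fun x => f (g x) := by
  simp only [PMF.map, eexpect_bind, Function.comp_apply, eexpect_pure]

lemma toOuterMeasure_eq_eexpect (p : PMF X) (s : Set X) :
    p.toOuterMeasure s = eexpect p (s.indicator fun _ => 1) := by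
  rw [PMF.toOuterMeasure_apply, eexpect]
  refine tsum_congr fun x => ?_
  by_cases hx : x ∈ s <;> simp [hx]

lemma one_sub_le_toOuterMeasure {p : PMF X} {s t : Set X} {δ : ℝ} (hδ : 0 ≤ δ)
    (hst : ∀ x ∈ p.support, x ∉ t → x ∈ s) (ht : p.toOuterMeasure t ≤ ENNReal.ofReal δ) :
    ENNReal.ofReal (1 - δ) ≤ p.toOuterMeasure s := by
  rw [ENNReal.ofReal_sub 1 hδ, ENNReal.ofReal_one, tsub_le_iff_right]
  calc (1 : ℝ≥0∞) = eexpect p (fun _ => 1) := (eexpect_const p 1).symm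
    _ ≤ eexpect p (fun x => s.indicator (fun _ => 1) x + t.indicator (fun _ => 1) x) := by
        refine eexpect_mono fun x hx => ?_
        by_cases hxt : x ∈ t
        · simp [hxt]
        · simp [hxt, hst x hx hxt]
    _ = p.toOuterMeasure s + p.toOuterMeasure t := by
        rw [eexpect_add, toOuterMeasure_eq_eexpect, toOuterMeasure_eq_eexpect]
    _ ≤ _ := by gcongr

/-! ### Bounded functions and real-valued expectations -/

/-- A real function bounded on the support of a discrete distribution. -/
def BddOn (p : PMF X) (f : X → ℝ) : Prop := ∃ B, ∀ x ∈ p.support, |f x| ≤ B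

namespace BddOn

variable {p : PMF X} {f g : X → ℝ}

lemma summable (h : BddOn p f) : Summable fun x => (p x).toReal * f x := by
  obtain ⟨B, hB⟩ := h
  have hp : Summable fun x => (p x).toReal := ENNReal.summable_toReal p.tsum_coe_ne_top
  refine Summable.of_norm_bounded (hp.mul_right B) fun x => ?_
  rw [norm_mul, Real.norm_of_nonneg ENNReal.toReal_nonneg, Real.norm_eq_abs]
  by_cases hx : p x = 0
  · simp [hx]
  · exact mul_le_mul_of_nonneg_left (hB x ((p.mem_support_iff x).2 hx)) ENNReal.toReal_nonneg

lemma add (hf : BddOn p f) (hg : BddOn p g) : BddOn p fun x => f x + g x := by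
  obtain ⟨B, hB⟩ := hf
  obtain ⟨B', hB'⟩ := hg
  exact ⟨B + B', fun x hx => (abs_add_le _ _).trans (add_le_add (hB x hx) (hB' x hx))⟩

lemma const_mul (a : ℝ) (hf : BddOn p f) : BddOn p fun x => a * f x := by
  obtain ⟨B, hB⟩ := hf
  refine ⟨|a| * B, fun x hx => ?_⟩
  rw [abs_mul]
  exact mul_le_mul_of_nonneg_left (hB x hx) (abs_nonneg a)

lemma sub (hf : BddOn p f) (hg : BddOn p g) : BddOn p fun x => f x - g x := by
  simpa [sub_eq_add_neg] using hf.add (hg.const_mul (-1))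

lemma const (p : PMF X) (a : ℝ) : BddOn p fun _ => a := ⟨|a|, fun _ _ => le_rfl⟩

end BddOn

variable {p : PMF X} {f g : X → ℝ}

lemma expect_add (hf : BddOn p f) (hg : BddOn p g) :
    expect p (fun x => f x + g x) = expect p f + expect p g := by
  simp only [expect, mul_add]
  exact hf.summable.tsum_add hg.summable

lemma expect_const_mul (p : PMF X) (a : ℝ) (f : X → ℝ) :
    expect p (fun x => a * f x) = a * expect p f := by
  simp only [expect, mul_left_comm _ a, tsum_mul_left]

lemma expect_sub (hf : BddOn p f) (hg : BddOn p g) :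
    expect p (fun x => f x - g x) = expect p f - expect p g := by
  have h := expect_add hf (hg.const_mul (-1))
  rw [expect_const_mul] at h
  simpa [sub_eq_add_neg] using h

@[simp]
lemma expect_const (p : PMF X) (a : ℝ) : expect p (fun _ => a) = a := by
  rw [expect, tsum_mul_right, ← ENNReal.tsum_toReal_eq p.apply_ne_top, p.tsum_coe]
  simp

lemma expect_congr (h : ∀ x ∈ p.support, f x = g x) : expect p f = expect p g := by
  refine tsum_congr fun x => ?_
  by_cases hx : p x = 0
  · simp [hx]
  · rw [h x ((p.mem_support_iff x).2 hx)]

lemma expect_nonneg (h : ∀ x ∈ p.support, 0 ≤ f x) : 0 ≤ expect p f := by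
  refine tsum_nonneg fun x => ?_
  by_cases hx : p x = 0
  · simp [hx]
  · exact mul_nonneg ENNReal.toReal_nonneg (h x ((p.mem_support_iff x).2 hx))

lemma expect_mono (hf : BddOn p f) (hg : BddOn p g) (h : ∀ x ∈ p.support, f x ≤ g x) :
    expect p f ≤ expect p g := by
  have := expect_nonneg (p := p) (f := fun x => g x - f x) fun x hx => sub_nonneg.2 (h x hx)
  rw [expect_sub hg hf] at this
  linarith

lemma expect_le_const (hf : BddOn p f) {a : ℝ} (h : ∀ x ∈ p.support, f x ≤ a) :
    expect p f ≤ a :=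
  (expect_mono hf (BddOn.const p a) h).trans_eq (expect_const p a)

lemma eq_zero_of_expect_nonpos (hf : BddOn p f) (h0 : ∀ x ∈ p.support, 0 ≤ f x)
    (h : expect p f ≤ 0) : ∀ x ∈ p.support, f x = 0 := by
  intro x hx
  have hnn : ∀ y, 0 ≤ (p y).toReal * f y := fun y => by
    by_cases hy : p y = 0
    · simp [hy]
    · exact mul_nonneg ENNReal.toReal_nonneg (h0 y ((p.mem_support_iff y).2 hy))
  have h1 : (p x).toReal * f x ≤ 0 := (hf.summable.le_tsum x fun y _ => hnn y).trans h
  have h2 : 0 < (p x).toReal := ENNReal.toReal_pos ((p.mem_support_iff x).1 hx) (p.apply_ne_top x)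
  nlinarith [h0 x hx]

lemma eexpect_ofReal (hf : BddOn p f) (h0 : ∀ x ∈ p.support, 0 ≤ f x) :
    eexpect p (fun x => ENNReal.ofReal (f x)) = ENNReal.ofReal (expect p f) := by
  have hnn : ∀ y, 0 ≤ (p y).toReal * f y := fun y => by
    by_cases hy : p y = 0
    · simp [hy]
    · exact mul_nonneg ENNReal.toReal_nonneg (h0 y ((p.mem_support_iff y).2 hy))
  rw [expect, ENNReal.ofReal_tsum_of_nonneg hnn hf.summable, eexpect]
  refine tsum_congr fun x => ?_
  rw [ENNReal.ofReal_mul ENNReal.toReal_nonneg, ENNReal.ofReal_toReal (p.apply_ne_top x)]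

/-- Shifting by `B` makes the integrand nonnegative, so real expectations inherit the rules proved
in `ℝ≥0∞`, where sums can be exchanged without summability conditions. -/
lemma expect_eq_toReal_eexpect {B : ℝ} (hB : ∀ x ∈ p.support, |f x| ≤ B) :
    expect p f = (eexpect p fun x => ENNReal.ofReal (f x + B)).toReal - B := by
  have hf : BddOn p f := ⟨B, hB⟩
  have h0 : ∀ x ∈ p.support, 0 ≤ f x + B := fun x hx => by linarith [neg_le_of_abs_le (hB x hx)]
  rw [eexpect_ofReal (hf.add (BddOn.const p B)) h0, ENNReal.toReal_ofReal (expect_nonneg h0),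
    expect_add hf (BddOn.const p B), expect_const]
  ring

lemma expect_map {g : Y → X} {q : PMF Y} (hf : BddOn (q.map g) f) :
    expect (q.map g) f = expect q fun y => f (g y) := by
  obtain ⟨B, hB⟩ := hf
  rw [expect_eq_toReal_eexpect hB, eexpect_map, expect_eq_toReal_eexpect (B := B)]
  exact fun y hy => hB _ ((PMF.mem_support_map_iff _ _ _).2 ⟨y, hy, rfl⟩)

/-- Hoeffding's lemma for discrete distributions. -/
lemma eexpect_exp_le {B : ℝ} (hB : ∀ x ∈ p.support, |f x| ≤ B) (l : ℝ) :
    eexpect p (fun x => ENNReal.ofReal (Real.exp (l * (expect p f - f x)))) ≤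
      ENNReal.ofReal (Real.exp (l ^ 2 * B ^ 2 / 2)) := by
  -- With the discrete σ-algebra every function is measurable, so the sub-Gaussian bound for bounded
  -- variables applies.
  let _ : MeasurableSpace X := ⊤
  have hf : BddOn p f := ⟨B, hB⟩
  have hae : ∀ᵐ x ∂p.toMeasure, x ∈ p.support := by
    rw [MeasureTheory.ae_iff]
    exact (PMF.toMeasure_apply_eq_zero_iff p (by trivial)).2
      (Set.disjoint_left.2 fun x hx hx' => hx' hx)
  have hm : ∀ h : X → ℝ, Measurable h := fun h => measurable_from_top
  have hint : ∀ h : X → ℝ, BddOn p h → expect p h = ∫ x, h x ∂p.toMeasure := by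
    rintro h ⟨K, hK⟩
    rw [PMF.integral_eq_tsum]
    · rfl
    · exact MeasureTheory.Integrable.of_bound (hm h).aestronglyMeasurable K
        (hae.mono fun x hx => hK x hx)
  -- The interval `[-B, B]` gives variance proxy `B²`; the parameter `-l` reverses the sign of the
  -- deviation.
  have hsub := (ProbabilityTheory.hasSubgaussianMGF_of_mem_Icc (μ := p.toMeasure) (X := f)
    (a := -B) (b := B) (hm f).aemeasurable
    (hae.mono fun x hx => abs_le.1 (hB x hx))).mgf_le (-l)
  have hbd : BddOn p fun x => Real.exp (l * (expect p f - f x)) := by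
    refine ⟨Real.exp (|l| * (|expect p f| + B)), fun x hx => ?_⟩
    rw [abs_of_pos (Real.exp_pos _), Real.exp_le_exp]
    refine (le_abs_self _).trans ?_
    rw [abs_mul]
    gcongr
    exact (abs_sub _ _).trans (by gcongr; exact hB x hx)
  rw [eexpect_ofReal hbd fun x _ => (Real.exp_pos _).le]
  refine ENNReal.ofReal_le_ofReal ?_
  rw [hint _ hbd]
  refine le_trans (le_of_eq ?_) (hsub.trans (le_of_eq ?_))
  · rw [ProbabilityTheory.mgf, ← hint f hf]
    congr 1 with x
    ring_nf
  · congr 1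
    push_cast
    rw [Real.norm_eq_abs, div_pow, sq_abs]
    ring

end Expectation

section Trajectories

variable {S A : Type*} {H : ℕ}

lemma polProb_cons (π : Policy S A) (x : S × A) (τ : Traj S A) :
    polProb π (x :: τ) = (π x.1 x.2).toReal * polProb π τ := by
  simp [polProb]

lemma polProb_nonneg (π : Policy S A) (τ : Traj S A) : 0 ≤ polProb π τ :=
  List.prod_nonneg fun a ha => by
    obtain ⟨x, -, rfl⟩ := List.mem_map.1 ha
    exact ENNReal.toReal_nonneg

namespace DCMDP

variable (M : DCMDP S A H)

/-! ### Trajectory distributions -/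

/-- Trajectories of a pair that start from the same initial state. -/
def AdmissiblePair (x : Traj S A × Traj S A) : Prop :=
  ∃ s ∈ M.init.support, ∃ as as' : List A, as.length = H ∧ as'.length = H ∧
    x = (M.path s as, M.path s as')

variable {M}

lemma AdmissiblePair.fst {x : Traj S A × Traj S A} (h : M.AdmissiblePair x) :
    M.Admissible x.1 := by
  obtain ⟨s, hs, as, _, ha, -, rfl⟩ := h
  exact ⟨s, hs, as, ha, rfl⟩

lemma AdmissiblePair.snd {x : Traj S A × Traj S A} (h : M.AdmissiblePair x) :
    M.Admissible x.2 := by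
  obtain ⟨s, hs, _, as, -, ha, rfl⟩ := h
  exact ⟨s, hs, as, ha, rfl⟩

variable (M)

lemma exists_path_of_mem_support_rollout (π : Policy S A) (n : ℕ) (s : S) (τ : Traj S A)
    (h : τ ∈ (M.rollout π n s).support) : ∃ as : List A, as.length = n ∧ τ = M.path s as := by
  induction n generalizing s τ with
  | zero =>
    refine ⟨[], rfl, ?_⟩
    simpa [rollout, path] using h
  | succ n ih =>
    simp only [rollout, PMF.mem_support_bind_iff, PMF.mem_support_map_iff] at h
    obtain ⟨a, -, τ', hτ', rfl⟩ := h
    obtain ⟨as, rfl, rfl⟩ := ih _ _ hτ'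
    exact ⟨a :: as, rfl, rfl⟩

lemma path_mem_support_rollout (π : Policy S A) (as : List A) (s : S)
    (h : 0 < polProb π (M.path s as)) : M.path s as ∈ (M.rollout π as.length s).support := by
  induction as generalizing s with
  | nil => simp [rollout, path]
  | cons a as ih =>
    rw [path, polProb_cons] at h
    have h1 : 0 < polProb π (M.path (M.next s a) as) :=
      (polProb_nonneg _ _).lt_of_ne fun h0 => by simp [← h0] at h
    have h2 : π s a ≠ 0 := fun h0 => by simp [h0] at h
    simp only [rollout, List.length_cons, PMF.mem_support_bind_iff, PMF.mem_support_map_iff]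
    exact ⟨a, (PMF.mem_support_iff _ _).2 h2, _, ih _ h1, rfl⟩

lemma exists_path_of_mem_support_response (ν : MixedPolicy S A) (s : S) (τ : Traj S A)
    (h : τ ∈ (M.response ν s).support) : ∃ as : List A, as.length = H ∧ τ = M.path s as := by
  simp only [response, PMF.mem_support_bind_iff] at h
  obtain ⟨π, -, h⟩ := h
  exact M.exists_path_of_mem_support_rollout π H s τ h

lemma admissible_of_mem_support_trajLaw {ν : MixedPolicy S A} {τ : Traj S A}
    (h : τ ∈ (M.trajLaw ν).support) : M.Admissible τ := by
  simp only [trajLaw, PMF.mem_support_bind_iff] at h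
  obtain ⟨s, hs, h⟩ := h
  obtain ⟨as, h1, h2⟩ := M.exists_path_of_mem_support_response ν s τ h
  exact ⟨s, hs, as, h1, h2⟩

lemma mem_support_trajLaw {π : Policy S A} {τ : Traj S A} (h : M.Admissible τ)
    (hp : 0 < polProb π τ) : τ ∈ (M.trajLaw (PMF.pure π)).support := by
  obtain ⟨s, hs, as, rfl, rfl⟩ := h
  simp only [trajLaw, response, PMF.pure_bind, PMF.mem_support_bind_iff]
  exact ⟨s, hs, M.path_mem_support_rollout π as s hp⟩

lemma admissiblePair_of_mem_support_pairLaw {π : Policy S A} {ν : MixedPolicy S A}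
    {x : Traj S A × Traj S A} (h : x ∈ (M.pairLaw π ν).support) : M.AdmissiblePair x := by
  simp only [pairLaw, PMF.mem_support_bind_iff, PMF.mem_support_map_iff] at h
  obtain ⟨s, hs, τ, hτ, τ', hτ', rfl⟩ := h
  obtain ⟨as, h1, rfl⟩ := M.exists_path_of_mem_support_rollout π H s τ hτ
  obtain ⟨as', h2, rfl⟩ := M.exists_path_of_mem_support_response ν s τ' hτ'
  exact ⟨s, hs, as, as', h1, h2, rfl⟩

lemma pairLaw_map_fst (π : Policy S A) (ν : MixedPolicy S A) :
    (M.pairLaw π ν).map Prod.fst = M.trajLaw (PMF.pure π) := by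
  simp only [pairLaw, trajLaw, response, PMF.map_bind, PMF.pure_bind, PMF.map_comp]
  congr 1 with s : 1
  have : ∀ τ : Traj S A, Prod.fst ∘ (fun τ' : Traj S A => (τ, τ')) = Function.const _ τ :=
    fun τ => rfl
  simp only [this, PMF.map_const, PMF.bind_pure, PMF.bind_const]

lemma pairLaw_map_snd (π : Policy S A) (ν : MixedPolicy S A) :
    (M.pairLaw π ν).map Prod.snd = M.trajLaw ν := by
  simp only [pairLaw, trajLaw, PMF.map_bind, PMF.map_comp]
  congr 1 with s : 1
  have : ∀ τ : Traj S A, Prod.snd ∘ (fun τ' : Traj S A => (τ, τ')) = id := fun τ => rfl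
  simp only [this, PMF.map_id, PMF.bind_const]

/-- A real function bounded on admissible trajectories. -/
def BddTraj (f : Traj S A → ℝ) : Prop := ∃ B, ∀ τ, M.Admissible τ → |f τ| ≤ B

variable {M}

lemma BddTraj.bddOn {f : Traj S A → ℝ} (h : M.BddTraj f) (ν : MixedPolicy S A) :
    BddOn (M.trajLaw ν) f := by
  obtain ⟨B, hB⟩ := h
  exact ⟨B, fun τ hτ => hB τ (M.admissible_of_mem_support_trajLaw hτ)⟩

lemma BddTraj.bddOn_fst {f : Traj S A → ℝ} (h : M.BddTraj f) (π : Policy S A)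
    (ν : MixedPolicy S A) : BddOn (M.pairLaw π ν) fun x => f x.1 := by
  obtain ⟨B, hB⟩ := h
  exact ⟨B, fun τ hτ => hB _ (M.admissiblePair_of_mem_support_pairLaw hτ).fst⟩

lemma BddTraj.bddOn_snd {f : Traj S A → ℝ} (h : M.BddTraj f) (π : Policy S A)
    (ν : MixedPolicy S A) : BddOn (M.pairLaw π ν) fun x => f x.2 := by
  obtain ⟨B, hB⟩ := h
  exact ⟨B, fun τ hτ => hB _ (M.admissiblePair_of_mem_support_pairLaw hτ).snd⟩

lemma expect_pairLaw_fst {f : Traj S A → ℝ} (h : M.BddTraj f) (π : Policy S A)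
    (ν : MixedPolicy S A) :
    expect (M.pairLaw π ν) (fun x => f x.1) = expect (M.trajLaw (PMF.pure π)) f := by
  rw [← M.pairLaw_map_fst π ν, expect_map]
  rw [M.pairLaw_map_fst π ν]
  exact h.bddOn _

lemma expect_pairLaw_snd {f : Traj S A → ℝ} (h : M.BddTraj f) (π : Policy S A)
    (ν : MixedPolicy S A) :
    expect (M.pairLaw π ν) (fun x => f x.2) = expect (M.trajLaw ν) f := by
  rw [← M.pairLaw_map_snd π ν, expect_map]
  rw [M.pairLaw_map_snd π ν]
  exact h.bddOn _

/-! ### Bounds on log-ratios and discrepancies, and the regret decomposition -/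

variable {πref : Policy S A} {Pol : Finset (Policy S A)} {β V R : ℝ}

lemma abs_mul_logRatio_le (hβ : 0 < β) (hV : M.BoundedRatio πref Pol β V) {π : Policy S A}
    (hπ : π ∈ Pol) {τ : Traj S A} (hτ : M.Admissible τ) : |β * logRatio π πref τ| ≤ V := by
  rw [abs_mul, abs_of_pos hβ]
  have := (hV π hπ τ hτ).2.2
  rwa [le_div_iff₀' hβ] at this

lemma abs_ret_le (hR : M.BoundedReturn R) {τ : Traj S A} (hτ : M.Admissible τ) :
    |M.ret τ| ≤ R := by
  rw [abs_of_nonneg (hR τ hτ).1]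
  exact (hR τ hτ).2

lemma abs_klReward_le (hβ : 0 < β) (hR : M.BoundedReturn R) (hV : M.BoundedRatio πref Pol β V)
    {π : Policy S A} (hπ : π ∈ Pol) {τ : Traj S A} (hτ : M.Admissible τ) :
    |M.klReward πref β π τ| ≤ R + V :=
  (abs_sub _ _).trans (add_le_add (abs_ret_le hR hτ) (abs_mul_logRatio_le hβ hV hπ hτ))

variable (M) in
lemma discrepancy_eq (πref : Policy S A) (β : ℝ) (π : Policy S A) (x : Traj S A × Traj S A) :
    M.discrepancy πref β π x = M.klReward πref β π x.2 - M.klReward πref β π x.1 := by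
  simp only [discrepancy, klReward]
  ring

lemma expect_discrepancy {π : Policy S A} (h : M.BddTraj (M.klReward πref β π))
    (ν : MixedPolicy S A) :
    expect (M.pairLaw π ν) (M.discrepancy πref β π) =
      expect (M.trajLaw ν) (M.klReward πref β π) - M.J πref β π := by
  rw [J, ← expect_pairLaw_snd h π ν, ← expect_pairLaw_fst h π ν,
    ← expect_sub (h.bddOn_snd π ν) (h.bddOn_fst π ν)]
  exact expect_congr fun x _ => M.discrepancy_eq πref β π x

lemma log_polProb_sub (hV : M.BoundedRatio πref Pol β V) {π π' : Policy S A} (hπ : π ∈ Pol)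
    (hπ' : π' ∈ Pol) {τ : Traj S A} (hτ : M.Admissible τ) :
    Real.log (polProb π τ) - Real.log (polProb π' τ) =
      logRatio π πref τ - logRatio π' πref τ := by
  have h := hV π hπ τ hτ
  have h' := hV π' hπ' τ hτ
  rw [logRatio, logRatio, Real.log_div h.2.1.ne' h.1.ne', Real.log_div h'.2.1.ne' h.1.ne']
  ring

/-- `β (log π(τ) - log π'(τ))`, expressed through density ratios. -/
def ratioGap (πref : Policy S A) (β : ℝ) (π π' : Policy S A) (τ : Traj S A) : ℝ :=
  β * logRatio π πref τ - β * logRatio π' πref τ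

lemma abs_ratioGap_le (hβ : 0 < β) (hV : M.BoundedRatio πref Pol β V) {π π' : Policy S A}
    (hπ : π ∈ Pol) (hπ' : π' ∈ Pol) {τ : Traj S A} (hτ : M.Admissible τ) :
    |ratioGap πref β π π' τ| ≤ 2 * V := by
  refine (abs_sub _ _).trans ?_
  linarith [abs_mul_logRatio_le hβ hV hπ hτ, abs_mul_logRatio_le hβ hV hπ' hτ]

/-- The regret of `π` against a policy with vanishing discrepancy. -/
lemma J_sub_J_eq (hβ : 0 < β) (hR : M.BoundedReturn R) (hV : M.BoundedRatio πref Pol β V)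
    {π πstar : Policy S A} (hπ : π ∈ Pol) (hstar : πstar ∈ Pol)
    (h0 : ∀ x, M.AdmissiblePair x → M.discrepancy πref β πstar x = 0) (ν : MixedPolicy S A) :
    M.J πref β πstar - M.J πref β π = expect (M.pairLaw π ν) (M.discrepancy πref β π) +
      expect (M.trajLaw ν) (ratioGap πref β π πstar) := by
  have hb : ∀ π ∈ Pol, M.BddTraj (M.klReward πref β π) :=
    fun π hπ => ⟨R + V, fun τ hτ => abs_klReward_le hβ hR hV hπ hτ⟩
  have h1 := expect_discrepancy (hb π hπ) ν
  -- Vanishing discrepancy makes `J` at `πstar` equal to the mean of its integrand under any sampler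
  -- `ν`.
  have h2 := expect_discrepancy (hb πstar hstar) ν
  rw [expect_congr (g := fun _ => 0)
    fun x hx => h0 x (M.admissiblePair_of_mem_support_pairLaw hx), expect_const] at h2
  have h3 : expect (M.trajLaw ν) (ratioGap πref β π πstar) =
      expect (M.trajLaw ν) (M.klReward πref β πstar) -
        expect (M.trajLaw ν) (M.klReward πref β π) := by
    rw [← expect_sub ((hb πstar hstar).bddOn ν) ((hb π hπ).bddOn ν)]
    exact expect_congr fun x _ => by simp only [klReward, ratioGap]; ring
  rw [h1, h3]
  linarith

variable (M) in
lemma exists_admissiblePair (π : Policy S A) : ∃ x, M.AdmissiblePair x := by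
  obtain ⟨x, hx⟩ := (M.pairLaw π (PMF.pure π)).support_nonempty
  exact ⟨x, M.admissiblePair_of_mem_support_pairLaw hx⟩

lemma BoundedRatio.nonneg (hβ : 0 < β) (hV : M.BoundedRatio πref Pol β V) {π : Policy S A}
    (hπ : π ∈ Pol) : 0 ≤ V := by
  obtain ⟨x, hx⟩ := M.exists_admissiblePair π
  exact (abs_nonneg _).trans (abs_mul_logRatio_le hβ hV hπ hx.fst)

lemma abs_discrepancy_le (hβ : 0 < β) (hR0 : 0 < R) (hR : M.BoundedReturn R)
    (hV : M.BoundedRatio πref Pol β V)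
    {π : Policy S A} (hπ : π ∈ Pol) {x : Traj S A × Traj S A} (hx : M.AdmissiblePair x) :
    |M.discrepancy πref β π x| ≤ 2 * (V + R) := by
  have h1 := abs_le.1 (abs_mul_logRatio_le hβ hV hπ hx.fst)
  have h2 := abs_le.1 (abs_mul_logRatio_le hβ hV hπ hx.snd)
  have h3 := hR _ hx.fst
  have h4 := hR _ hx.snd
  simp only [Set.mem_Icc] at h3 h4
  rw [discrepancy, abs_le]
  constructor <;> linarith

/-- When `V = 0` all log-ratios vanish, so every policy of the class has the discrepancy of `πstar`.
This covers the case where a SEC denominator can be zero. -/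
lemma discrepancy_eq_zero_of_ratio_eq_zero (hβ : 0 < β) (hV : M.BoundedRatio πref Pol β 0)
    {π πstar : Policy S A} (hπ : π ∈ Pol) (hstar : πstar ∈ Pol)
    (h0 : ∀ x, M.AdmissiblePair x → M.discrepancy πref β πstar x = 0)
    {x : Traj S A × Traj S A} (hx : M.AdmissiblePair x) : M.discrepancy πref β π x = 0 := by
  have h := h0 x hx
  have h1 := abs_nonpos_iff.1 (abs_mul_logRatio_le hβ hV hπ hx.fst)
  have h2 := abs_nonpos_iff.1 (abs_mul_logRatio_le hβ hV hπ hx.snd)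
  have h3 := abs_nonpos_iff.1 (abs_mul_logRatio_le hβ hV hstar hx.fst)
  have h4 := abs_nonpos_iff.1 (abs_mul_logRatio_le hβ hV hstar hx.snd)
  simp only [discrepancy] at h ⊢
  rw [h3, h4] at h
  rw [h1, h2, h]

/-- The regret of any policy at least as good as the reference policy is trivially bounded. -/
lemma J_sub_J_ref_le (hβ : 0 < β) (hR : M.BoundedReturn R) (hV : M.BoundedRatio πref Pol β V)
    {πstar : Policy S A} (hstar : πstar ∈ Pol)
    (h0 : ∀ x, M.AdmissiblePair x → M.discrepancy πref β πstar x = 0) :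
    M.J πref β πstar - M.J πref β πref ≤ V + R := by
  have hb : M.BddTraj (M.klReward πref β πstar) :=
    ⟨R + V, fun τ hτ => abs_klReward_le hβ hR hV hstar hτ⟩
  have h2 := expect_discrepancy hb (PMF.pure πref)
  rw [expect_congr (g := fun _ => 0)
    fun x hx => h0 x (M.admissiblePair_of_mem_support_pairLaw hx), expect_const] at h2
  have h3 : expect (M.trajLaw (PMF.pure πref)) (M.klReward πref β πstar) ≤ R + V :=
    expect_le_const (hb.bddOn _) fun τ hτ => (le_abs_self _).trans
      (abs_klReward_le hβ hR hV hstar (M.admissible_of_mem_support_trajLaw hτ))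
  -- Against itself `πref` pays no KL cost, so only its nonnegative return remains.
  have h4 : 0 ≤ M.J πref β πref := by
    refine expect_nonneg fun τ hτ => ?_
    have hτ' := M.admissible_of_mem_support_trajLaw hτ
    rw [klReward, logRatio, div_self (hV πstar hstar τ hτ').1.ne', Real.log_one, mul_zero, sub_zero]
    exact (hR τ hτ').1
  linarith

end DCMDP

end Trajectories

section Gibbs
namespace DCMDP

variable {S A : Type*} {H : ℕ} (M : DCMDP S A H)

/-! ### The optimal policy is the Gibbs policy -/

/-- The exponentially weighted return `exp (r(τ) / β)`. -/
def expReturn (β : ℝ) (τ : Traj S A) : ℝ≥0∞ := ENNReal.ofReal (Real.exp (M.ret τ / β))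

/-- The partition function: expectation of `exp (r(τ) / β)` over `n` steps of `π_ref`. -/
def partitionFn (πref : Policy S A) (β : ℝ) (n : ℕ) (s : S) : ℝ≥0∞ :=
  eexpect (M.rollout πref n s) (M.expReturn β)

/-- The unnormalized Gibbs weights of the actions in state `s`, with `n + 1` steps to go. -/
def gibbsWeight (πref : Policy S A) (β : ℝ) (n : ℕ) (s : S) (a : A) : ℝ≥0∞ :=
  πref s a * (ENNReal.ofReal (Real.exp (M.reward s a / β)) *
    M.partitionFn πref β n (M.next s a))

variable {M}

lemma ret_cons (x : S × A) (τ : Traj S A) : M.ret (x :: τ) = M.reward x.1 x.2 + M.ret τ := by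
  simp [ret]

lemma expReturn_cons (β : ℝ) (x : S × A) (τ : Traj S A) :
    M.expReturn β (x :: τ) =
      ENNReal.ofReal (Real.exp (M.reward x.1 x.2 / β)) * M.expReturn β τ := by
  rw [expReturn, expReturn, ← ENNReal.ofReal_mul (Real.exp_pos _).le, ← Real.exp_add, ret_cons,
    add_div]

lemma partitionFn_succ (πref : Policy S A) (β : ℝ) (n : ℕ) (s : S) :
    M.partitionFn πref β (n + 1) s = ∑' a, M.gibbsWeight πref β n s a := by
  simp only [partitionFn, rollout, eexpect_bind, eexpect_map, expReturn_cons, eexpect_const_mul]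
  rfl

lemma partitionFn_ne_zero (πref : Policy S A) (β : ℝ) (n : ℕ) (s : S) :
    M.partitionFn πref β n s ≠ 0 := by
  obtain ⟨τ, hτ⟩ := (M.rollout πref n s).support_nonempty
  rw [partitionFn, eexpect, ne_eq, ENNReal.tsum_eq_zero, not_forall]
  refine ⟨τ, mul_ne_zero ((PMF.mem_support_iff _ _).1 hτ) ?_⟩
  simp [expReturn, Real.exp_pos]

variable (M) in
/-- The Gibbs policy `π(a ∣ s) ∝ π_ref(a ∣ s) exp (r(s, a) / β) Z(s')`. -/
def gibbsPolicy (πref : Policy S A) (β : ℝ) : Policy S A := fun s =>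
  -- The layer of `s` fixes the number of remaining steps, so the policy needs no time argument.
  -- Where the weights have infinite total mass, `πref` is a mere default.
  open Classical in
  if h : (∑' a, M.gibbsWeight πref β (H - M.layer s - 1) s a) ≠ ⊤ then
    PMF.normalize (M.gibbsWeight πref β (H - M.layer s - 1) s)
      (by rw [← partitionFn_succ]; exact partitionFn_ne_zero _ _ _ _) h
  else πref s

lemma gibbsPolicy_mul_partitionFn {πref : Policy S A} {β : ℝ} {n : ℕ} {s : S}
    (hn : (M.layer s : ℕ) + (n + 1) = H) (hZ : M.partitionFn πref β (n + 1) s ≠ ⊤) (a : A) :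
    M.gibbsPolicy πref β s a * M.partitionFn πref β (n + 1) s = M.gibbsWeight πref β n s a := by
  have hn' : H - M.layer s - 1 = n := by omega
  have h : (∑' a, M.gibbsWeight πref β (H - M.layer s - 1) s a) ≠ ⊤ := by
    rwa [hn', ← partitionFn_succ]
  rw [gibbsPolicy, dif_pos h, PMF.normalize_apply, hn', ← partitionFn_succ, mul_assoc,
    ENNReal.inv_mul_cancel (partitionFn_ne_zero _ _ _ _) hZ, mul_one]

/-- The partition functions telescope: the normaliser of a state cancels the successor factor in the
preceding weight. The empty list is a separate alternative because nothing is known about the layer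
of a state reached after the last step. -/
lemma polProb_gibbsPolicy_mul {πref : Policy S A} {β : ℝ} (as : List A) (s : S)
    (hn : as = [] ∨ (M.layer s : ℕ) + as.length = H)
    (hZ : M.partitionFn πref β as.length s ≠ ⊤) (hp : 0 < polProb πref (M.path s as)) :
    polProb (M.gibbsPolicy πref β) (M.path s as) * (M.partitionFn πref β as.length s).toReal =
      polProb πref (M.path s as) * Real.exp (M.ret (M.path s as) / β) := by
  induction as generalizing s with
  | nil =>
    simp [path, polProb, partitionFn, rollout, expReturn, ret]
  | cons a as ih =>
    simp only [reduceCtorEq, false_or, List.length_cons] at hn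
    rw [path, polProb_cons] at hp
    have hp1 : 0 < polProb πref (M.path (M.next s a) as) :=
      (polProb_nonneg _ _).lt_of_ne fun h0 => by simp [← h0] at hp
    have hp2 : πref s a ≠ 0 := fun h0 => by simp [h0] at hp
    have hmul := gibbsPolicy_mul_partitionFn hn hZ a
    have hle : M.gibbsWeight πref β as.length s a ≤ M.partitionFn πref β (as.length + 1) s := by
      rw [partitionFn_succ]
      exact ENNReal.le_tsum a
    -- Finiteness passes to the successor because `πref` gives the action positive mass.
    have hfin : M.partitionFn πref β as.length (M.next s a) ≠ ⊤ := by
      intro h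
      refine hZ (top_le_iff.1 (le_trans (le_of_eq ?_) hle))
      rw [gibbsWeight, h, ENNReal.mul_top, ENNReal.mul_top hp2]
      simp [Real.exp_pos]
    have hlay : as = [] ∨ (M.layer (M.next s a) : ℕ) + as.length = H := by
      rcases as.eq_nil_or_concat with h | ⟨_, _, h⟩
      · exact Or.inl h
      · right
        have : 0 < as.length := by rw [h]; simp
        rw [M.layer_next s a (by omega)]
        omega
    have hrec := ih (M.next s a) hlay hfin hp1
    have hreal : (M.gibbsPolicy πref β s a).toReal *
        (M.partitionFn πref β (as.length + 1) s).toReal = (πref s a).toReal *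
          (Real.exp (M.reward s a / β) * (M.partitionFn πref β as.length (M.next s a)).toReal) := by
      rw [← ENNReal.toReal_mul, hmul, gibbsWeight, ENNReal.toReal_mul, ENNReal.toReal_mul,
        ENNReal.toReal_ofReal (Real.exp_pos _).le]
    rw [path, polProb_cons, polProb_cons, ret_cons, add_div, Real.exp_add, List.length_cons]
    linear_combination (polProb (M.gibbsPolicy πref β) (M.path (M.next s a) as)) * hreal +
      (πref s a).toReal * Real.exp (M.reward s a / β) * hrec

/-- At each step the importance weights collect the mass of `π'` on the support of `π`. This gives
an inequality without any absolute continuity. -/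
lemma eexpect_rollout_ratio_le_one (π π' : Policy S A) (n : ℕ) (s : S) :
    eexpect (M.rollout π n s) (fun τ => ENNReal.ofReal (polProb π' τ / polProb π τ)) ≤ 1 := by
  induction n generalizing s with
  | zero => simp [rollout, polProb]
  | succ n ih =>
    rw [rollout, eexpect_bind]
    simp only [eexpect_map, polProb_cons, mul_div_mul_comm]
    calc _ ≤ eexpect (π s) fun a => ENNReal.ofReal ((π' s a).toReal / (π s a).toReal) := by
          refine eexpect_mono fun a _ => ?_
          simp only [ENNReal.ofReal_mul (div_nonneg ENNReal.toReal_nonneg ENNReal.toReal_nonneg),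
            eexpect_const_mul]
          exact mul_le_of_le_one_right' (ih _)
      _ ≤ ∑' a, π' s a := by
          refine ENNReal.tsum_le_tsum fun a => ?_
          by_cases h : π s a = 0
          · simp [h]
          · beta_reduce
            rw [ENNReal.ofReal_div_of_pos (ENNReal.toReal_pos h ((π s).apply_ne_top a)),
              ENNReal.ofReal_toReal ((π s).apply_ne_top a),
              ENNReal.ofReal_toReal ((π' s).apply_ne_top a)]
            exact ENNReal.mul_div_le
      _ = 1 := (π' s).tsum_coe

lemma eexpect_trajLaw_ratio_le_one (π π' : Policy S A) :
    eexpect (M.trajLaw (PMF.pure π)) (fun τ => ENNReal.ofReal (polProb π' τ / polProb π τ)) ≤ 1 := by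
  simp only [trajLaw, response, PMF.pure_bind, eexpect_bind]
  exact eexpect_le_const fun s _ => eexpect_rollout_ratio_le_one π π' H s

lemma layer_add_eq {s : S} (hs : s ∈ M.init.support) : (M.layer s : ℕ) + H = H := by
  rw [M.layer_init s hs, zero_add]

variable {πref πstar : Policy S A} {β V R : ℝ} {Pol : Finset (Policy S A)}

lemma partitionFn_init_le (hβ : 0 < β) (hR : M.BoundedReturn R) {s : S}
    (hs : s ∈ M.init.support) :
    M.partitionFn πref β H s ≤ ENNReal.ofReal (Real.exp (R / β)) := by
  refine eexpect_le_const fun τ hτ => ENNReal.ofReal_le_ofReal (Real.exp_le_exp.2 ?_)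
  obtain ⟨as, h1, rfl⟩ := M.exists_path_of_mem_support_rollout πref H s τ hτ
  gcongr
  exact (hR _ ⟨s, hs, as, h1, rfl⟩).2

lemma one_le_partitionFn_init (hβ : 0 < β) (hR : M.BoundedReturn R) {s : S}
    (hs : s ∈ M.init.support) : 1 ≤ M.partitionFn πref β H s := by
  rw [← eexpect_const (M.rollout πref H s) 1]
  refine eexpect_mono fun τ hτ => ?_
  obtain ⟨as, h1, rfl⟩ := M.exists_path_of_mem_support_rollout πref H s τ hτ
  rw [expReturn, ENNReal.one_le_ofReal, Real.one_le_exp_iff]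
  exact div_nonneg (hR _ ⟨s, hs, as, h1, rfl⟩).1 hβ.le

lemma polProb_gibbsPolicy_pos_and_klReward (hβ : 0 < β) (hR : M.BoundedReturn R)
    {s : S} (hs : s ∈ M.init.support) {as : List A} (has : as.length = H)
    (hp : 0 < polProb πref (M.path s as)) :
    0 < polProb (M.gibbsPolicy πref β) (M.path s as) ∧
      M.klReward πref β (M.gibbsPolicy πref β) (M.path s as) =
        β * Real.log (M.partitionFn πref β H s).toReal := by
  have hle := partitionFn_init_le (πref := πref) hβ hR hs
  have hge := one_le_partitionFn_init (πref := πref) hβ hR hs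
  have hfin : M.partitionFn πref β H s ≠ ⊤ := ne_top_of_le_ne_top ENNReal.ofReal_ne_top hle
  have hz : 0 < (M.partitionFn πref β H s).toReal :=
    ENNReal.toReal_pos (partitionFn_ne_zero _ _ _ _) hfin
  have h := polProb_gibbsPolicy_mul (πref := πref) (β := β) as s
    (Or.inr (has ▸ layer_add_eq hs)) (has ▸ hfin) hp
  rw [has] at h
  have hpos : 0 < polProb (M.gibbsPolicy πref β) (M.path s as) := by
    have h1 : 0 < polProb (M.gibbsPolicy πref β) (M.path s as) *
        (M.partitionFn πref β H s).toReal := by rw [h]; positivity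
    exact pos_of_mul_pos_left h1 hz.le
  refine ⟨hpos, ?_⟩
  have h2 := congrArg Real.log h
  rw [Real.log_mul hpos.ne' hz.ne', Real.log_mul hp.ne' (Real.exp_pos _).ne', Real.log_exp] at h2
  rw [klReward, logRatio, Real.log_div hpos.ne' hp.ne']
  have h3 : M.ret (M.path s as) = β * (M.ret (M.path s as) / β) := by field_simp
  rw [h3]
  linear_combination (-β) * h2

/-- An optimal policy has vanishing discrepancy: `β log (π(τ) / π_ref(τ)) - r(τ)` depends only on
the initial state. -/
theorem IsOptimal.discrepancy_eq_zero (hβ : 0 < β) (hR : M.BoundedReturn R)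
    (hV : M.BoundedRatio πref Pol β V) (hstar : πstar ∈ Pol) (hopt : M.IsOptimal πref β πstar)
    (x : Traj S A × Traj S A) (hx : M.AdmissiblePair x) :
    M.discrepancy πref β πstar x = 0 := by
  set πg := M.gibbsPolicy πref β with hπg
  have hg : ∀ s ∈ M.init.support, ∀ as : List A, as.length = H →
      0 < polProb πg (M.path s as) ∧ M.klReward πref β πg (M.path s as) =
        β * Real.log (M.partitionFn πref β H s).toReal := fun s hs as has =>
    polProb_gibbsPolicy_pos_and_klReward hβ hR hs has (hV πstar hstar _ ⟨s, hs, as, has, rfl⟩).1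
  have hgpos : ∀ τ, M.Admissible τ → 0 < polProb πg τ := by
    rintro τ ⟨s, hs, as, has, rfl⟩
    exact (hg s hs as has).1
  have hgconst : ∀ x, M.AdmissiblePair x →
      M.klReward πref β πg x.1 = M.klReward πref β πg x.2 := by
    rintro _ ⟨s, hs, as, as', has, has', rfl⟩
    rw [(hg s hs as has).2, (hg s hs as' has').2]
  -- Boundedness makes `J` finite at the Gibbs policy, so optimality can be tested against it.
  have hgb : M.BddTraj (M.klReward πref β πg) := by
    refine ⟨R, ?_⟩
    rintro τ ⟨s, hs, as, has, rfl⟩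
    have h1 := ENNReal.toReal_mono ENNReal.ofReal_ne_top
      (partitionFn_init_le (πref := πref) hβ hR hs)
    have h2 := ENNReal.toReal_mono (ne_top_of_le_ne_top ENNReal.ofReal_ne_top
      (partitionFn_init_le (πref := πref) hβ hR hs)) (one_le_partitionFn_init (πref := πref) hβ hR hs)
    rw [ENNReal.toReal_ofReal (Real.exp_pos _).le] at h1
    rw [ENNReal.toReal_one] at h2
    have h3 : Real.log (M.partitionFn πref β H s).toReal ≤ R / β := by
      rw [← Real.log_exp (R / β)]
      exact Real.log_le_log (by linarith) h1
    rw [(hg s hs as has).2, abs_of_nonneg (mul_nonneg hβ.le (Real.log_nonneg h2))]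
    calc _ ≤ β * (R / β) := by gcongr
      _ = R := by field_simp
  have hsb : M.BddTraj (M.klReward πref β πstar) :=
    ⟨R + V, fun τ hτ => abs_klReward_le hβ hR hV hstar hτ⟩
  have hJ : M.J πref β πg ≤ M.J πref β πstar := hopt.2 πg (hgb.bddOn _).summable
  -- The integrand of the Gibbs policy depends only on the initial state, so its mean may be taken
  -- under `πstar`.
  have hJg : M.J πref β πg = expect (M.trajLaw (PMF.pure πstar)) (M.klReward πref β πg) := by
    rw [← expect_pairLaw_fst hgb πstar (PMF.pure πg), J,
      ← expect_pairLaw_snd hgb πstar (PMF.pure πg)]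
    exact expect_congr fun x hx => (hgconst x (M.admissiblePair_of_mem_support_pairLaw hx)).symm
  -- `u τ = log (π_g(τ) / π⋆(τ))`
  set u : Traj S A → ℝ := fun τ => Real.log (polProb πg τ / polProb πstar τ) with hu
  have hukl : ∀ τ, M.Admissible τ →
      β * u τ = M.klReward πref β πstar τ - M.klReward πref β πg τ := by
    intro τ hτ
    have h1 := hV πstar hstar τ hτ
    simp only [klReward, logRatio, hu]
    rw [Real.log_div (hgpos τ hτ).ne' h1.2.1.ne',
      Real.log_div (hgpos τ hτ).ne' h1.1.ne', Real.log_div h1.2.1.ne' h1.1.ne']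
    ring
  have hub : M.BddTraj u := by
    obtain ⟨B, hB⟩ := hgb
    obtain ⟨B', hB'⟩ := hsb
    refine ⟨(B' + B) / β, fun τ hτ => ?_⟩
    have h1 : β * |u τ| = |β * u τ| := by rw [abs_mul, abs_of_pos hβ]
    rw [le_div_iff₀' hβ, h1, hukl τ hτ]
    exact (abs_sub _ _).trans (add_le_add (hB' τ hτ) (hB τ hτ))
  have hexp : ∀ τ, M.Admissible τ → Real.exp (u τ) = polProb πg τ / polProb πstar τ :=
    fun τ hτ => Real.exp_log (div_pos (hgpos τ hτ) (hV πstar hstar τ hτ).2.1)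
  have hqb : M.BddTraj fun τ => Real.exp (u τ) := by
    obtain ⟨B, hB⟩ := hub
    refine ⟨Real.exp B, fun τ hτ => ?_⟩
    rw [abs_of_pos (Real.exp_pos _)]
    exact Real.exp_le_exp.2 ((le_abs_self _).trans (hB τ hτ))
  set P := M.trajLaw (PMF.pure πstar) with hP
  have hEu : 0 ≤ expect P u := by
    have h1 : β * expect P u = M.J πref β πstar - M.J πref β πg := by
      rw [hJg, J, ← expect_sub (hsb.bddOn _) (hgb.bddOn _), ← expect_const_mul]
      exact expect_congr fun τ hτ => hukl τ (M.admissible_of_mem_support_trajLaw hτ)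
    exact nonneg_of_mul_nonneg_right (by rw [h1]; linarith) hβ
  have hEq : expect P (fun τ => Real.exp (u τ)) ≤ 1 := by
    have h1 := eexpect_trajLaw_ratio_le_one (M := M) πstar πg
    rw [← eexpect_congr (f := fun τ => ENNReal.ofReal (Real.exp (u τ))) fun τ hτ => by
      rw [hexp τ (M.admissible_of_mem_support_trajLaw hτ)]] at h1
    rwa [eexpect_ofReal (hqb.bddOn _) fun τ _ => (Real.exp_pos _).le, ENNReal.ofReal_le_one] at h1
  -- This is the equality case of Gibbs' inequality: `E u ≥ 0` and `E (exp u) ≤ 1` force the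
  -- nonnegative function `exp u - u - 1` to vanish on the support, which contains every admissible
  -- trajectory since `πstar` is positive there.
  have hzero := eq_zero_of_expect_nonpos (p := P) (f := fun τ => Real.exp (u τ) - (u τ + 1))
    ((hqb.bddOn _).sub ((hub.bddOn _).add (BddOn.const _ 1)))
    (fun τ _ => sub_nonneg.2 (Real.add_one_le_exp _))
    (by
      rw [expect_sub (hqb.bddOn _) ((hub.bddOn _).add (BddOn.const _ 1)),
        expect_add (hub.bddOn _) (BddOn.const _ 1), expect_const]
      linarith)
  have hu0 : ∀ τ, M.Admissible τ → u τ = 0 := by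
    intro τ hτ
    have h1 := hzero τ (M.mem_support_trajLaw hτ (hV πstar hstar τ hτ).2.1)
    by_contra h2
    linarith [Real.add_one_lt_exp h2]
  have e1 := hukl _ hx.fst
  have e2 := hukl _ hx.snd
  rw [hu0 _ hx.fst] at e1
  rw [hu0 _ hx.snd] at e2
  rw [discrepancy_eq]
  linarith [hgconst x hx]

end DCMDP

end Gibbs

section Likelihood

/-! ### Information-theoretic bounds for the logistic model -/

/-- One minus the affinity is half the sum of the two squared differences of square roots, and on
`[0, 1]` one has `|a - b| ≤ 2 |√a - √b|`. -/
lemma sqrt_mul_add_sqrt_mul_le {p q : ℝ} (hp0 : 0 ≤ p) (hp1 : p ≤ 1) (hq0 : 0 ≤ q) (hq1 : q ≤ 1) :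
    √(p * q) + √((1 - p) * (1 - q)) ≤ 1 - (p - q) ^ 2 / 4 := by
  have key : ∀ {a b : ℝ}, 0 ≤ a → a ≤ 1 → 0 ≤ b → b ≤ 1 →
      (a - b) ^ 2 ≤ 4 * (√a - √b) ^ 2 := by
    intro a b ha0 ha1 hb0 hb1
    have h1 : a - b = (√a - √b) * (√a + √b) := by
      ring_nf
      rw [Real.sq_sqrt ha0, Real.sq_sqrt hb0]
    have h2 : √a ≤ 1 := Real.sqrt_le_one.2 ha1
    have h3 : √b ≤ 1 := Real.sqrt_le_one.2 hb1
    have h4 : (√a + √b) ^ 2 ≤ 4 := by nlinarith [Real.sqrt_nonneg a, Real.sqrt_nonneg b]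
    rw [h1, mul_pow]
    nlinarith [sq_nonneg (√a - √b)]
  have h1 := key hp0 hp1 hq0 hq1
  have h2 := key (sub_nonneg.2 hp1) (sub_le_self 1 hp0) (sub_nonneg.2 hq1) (sub_le_self 1 hq0)
  rw [Real.sqrt_mul hp0, Real.sqrt_mul (sub_nonneg.2 hp1)]
  have e1 := Real.sq_sqrt hp0
  have e2 := Real.sq_sqrt hq0
  have e3 := Real.sq_sqrt (sub_nonneg.2 hp1)
  have e4 := Real.sq_sqrt (sub_nonneg.2 hq1)
  nlinarith

lemma exp_neg_abs_le_sigmoid_mul (z : ℝ) :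
    Real.exp (-|z|) / 4 ≤ Real.sigmoid z * (1 - Real.sigmoid z) := by
  rw [← Real.sigmoid_neg, Real.sigmoid_def, Real.sigmoid_def, neg_neg, ← mul_inv, Real.exp_neg,
    ← one_div, ← one_div, div_div]
  refine one_div_le_one_div_of_le (by positivity) ?_
  have h1 : Real.exp z ≤ Real.exp |z| := Real.exp_le_exp.2 (le_abs_self z)
  have h2 : Real.exp (-z) ≤ Real.exp |z| := Real.exp_le_exp.2 (neg_le_abs z)
  have h3 : Real.exp (-z) * Real.exp z = 1 := by rw [← Real.exp_add]; simp
  have h4 : 1 ≤ Real.exp |z| := Real.one_le_exp (abs_nonneg z)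
  nlinarith

/-- The difference factors as `σ(x) (1 - σ(z)) (1 - exp (-(x - z)))`. Only the slope at `z` enters;
with `z` the true return gap, the exponential loss will depend on `R` alone and not on `V`. -/
lemma sigmoid_sub_sigmoid_ge {x z : ℝ} (h : z ≤ x) :
    Real.exp (-|z|) / 4 * ((x - z) / (1 + (x - z))) ≤ Real.sigmoid x - Real.sigmoid z := by
  have hu : 0 ≤ x - z := sub_nonneg.2 h
  have h1 : (x - z) / (1 + (x - z)) ≤ 1 - Real.exp (-(x - z)) := by
    have h2 : Real.exp (-(x - z)) ≤ 1 / (1 + (x - z)) := by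
      rw [Real.exp_neg, ← one_div]
      exact one_div_le_one_div_of_le (by linarith) (by linarith [Real.add_one_le_exp (x - z)])
    have h3 : (x - z) / (1 + (x - z)) = 1 - 1 / (1 + (x - z)) := by
      field_simp
      ring
    linarith
  have h0 : 0 ≤ (x - z) / (1 + (x - z)) := div_nonneg hu (by linarith)
  have hs : Real.sigmoid z ≤ Real.sigmoid x := Real.sigmoid_le h
  have hz := Real.sigmoid_lt_one z
  have e : Real.sigmoid x - Real.sigmoid z =
      Real.sigmoid x * (1 - Real.sigmoid z) * (1 - Real.exp (-(x - z))) := by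
    have hx' : Real.sigmoid x = (1 + Real.exp (-x))⁻¹ := rfl
    have hz' : Real.sigmoid z = (1 + Real.exp (-z))⁻¹ := rfl
    have he : Real.exp (-(x - z)) * Real.exp (-z) = Real.exp (-x) := by
      rw [← Real.exp_add]; ring_nf
    rw [hx', hz', ← he]
    have p1 : 0 < 1 + Real.exp (-(x - z)) * Real.exp (-z) := by positivity
    have p2 : 0 < 1 + Real.exp (-z) := by positivity
    field_simp
    ring
  rw [e]
  calc _ ≤ Real.sigmoid z * (1 - Real.sigmoid z) * ((x - z) / (1 + (x - z))) := by
        gcongr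
        exact exp_neg_abs_le_sigmoid_mul z
    _ ≤ _ := by
        have : 0 ≤ 1 - Real.sigmoid z := by linarith
        have := Real.sigmoid_nonneg x
        gcongr

/-- From `|x - z| ≤ 2W` and `1 ≤ W`, the denominator `1 + |x - z|` is at most `3W`, whence `12 = 4 ·
3`. The reflection `σ(-x) = 1 - σ(x)` reduces to `z ≤ x`. -/
lemma abs_sigmoid_sub_sigmoid_ge {x z R W : ℝ} (hz : |z| ≤ R) (hW : 1 ≤ W)
    (hxz : |x - z| ≤ 2 * W) :
    Real.exp (-R) * |x - z| / (12 * W) ≤ |Real.sigmoid x - Real.sigmoid z| := by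
  have key : ∀ {x z : ℝ}, z ≤ x → |z| ≤ R → |x - z| ≤ 2 * W →
      Real.exp (-R) * |x - z| / (12 * W) ≤ |Real.sigmoid x - Real.sigmoid z| := by
    intro x z h hz hxz
    have h0 := sub_nonneg.2 h
    rw [abs_of_nonneg h0] at hxz ⊢
    refine le_trans ?_ ((sigmoid_sub_sigmoid_ge h).trans (le_abs_self _))
    calc Real.exp (-R) * (x - z) / (12 * W) = Real.exp (-R) / 4 * ((x - z) / (3 * W)) := by
          field_simp
          ring
      _ ≤ _ := by
          have : 0 < 1 + (x - z) := by linarith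
          gcongr
          linarith
  rcases le_total z x with h | h
  · exact key h hz hxz
  · have := key (x := -x) (z := -z) (neg_le_neg h) (by rwa [abs_neg])
      (by rwa [← abs_neg, show -(-x - -z) = x - z by ring])
    rw [Real.sigmoid_neg, Real.sigmoid_neg, ← abs_neg (-x - -z),
      ← abs_neg (1 - Real.sigmoid x - _)] at this
    rwa [show -(-x - -z) = x - z by ring,
      show -(1 - Real.sigmoid x - (1 - Real.sigmoid z)) = Real.sigmoid x - Real.sigmoid z by ring]
      at this

/-- The affinity of two logistic preference models. -/
lemma sqrt_sigmoid_add_sqrt_sigmoid_le {x z R W : ℝ} (hz : |z| ≤ R) (hW : 1 ≤ W)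
    (hxz : |x - z| ≤ 2 * W) :
    √(Real.sigmoid x * Real.sigmoid z) + √(Real.sigmoid (-x) * Real.sigmoid (-z)) ≤
      1 - (x - z) ^ 2 / (576 * W ^ 2 * Real.exp (2 * R)) := by
  rw [Real.sigmoid_neg, Real.sigmoid_neg]
  refine (sqrt_mul_add_sqrt_mul_le (Real.sigmoid_nonneg x) (Real.sigmoid_le_one x)
    (Real.sigmoid_nonneg z) (Real.sigmoid_le_one z)).trans ?_
  have h1 := abs_sigmoid_sub_sigmoid_ge hz hW hxz
  have h2 : (Real.exp (-R) * |x - z| / (12 * W)) ^ 2 ≤ (Real.sigmoid x - Real.sigmoid z) ^ 2 := by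
    rw [← sq_abs (Real.sigmoid x - _)]
    have : 0 ≤ Real.exp (-R) * |x - z| / (12 * W) := by positivity
    gcongr
  -- The constant is `576 = 4 · 12²`.
  have h3 : (Real.exp (-R) * |x - z| / (12 * W)) ^ 2 / 4 =
      (x - z) ^ 2 / (576 * W ^ 2 * Real.exp (2 * R)) := by
    rw [div_pow, mul_pow, sq_abs, Real.exp_neg, two_mul R, Real.exp_add]
    field_simp
    ring
  linarith

/-! ### The likelihood ratio of one comparison -/

variable {S A : Type*} {H : ℕ}

/-- The log-likelihood of a labelled pair under the preference model induced by `π`. -/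
def logLik (πref : Policy S A) (β : ℝ) (π : Policy S A) (x : Traj S A × Traj S A) : ℝ :=
  Real.log (Real.sigmoid (β * logRatio π πref x.1 - β * logRatio π πref x.2))

/-- The pair of trajectories `x` labelled by `y`: the preferred one comes first. -/
def labelled (x : Traj S A × Traj S A) (y : Bool) : Traj S A × Traj S A :=
  if y then (x.1, x.2) else (x.2, x.1)

/-- `576 (V + R)² e^{2 R}`. -/
def infoConst (V R : ℝ) : ℝ := 576 * (V + R) ^ 2 * Real.exp (2 * R)

lemma infoConst_pos {V R : ℝ} (hW : 1 ≤ V + R) : 0 < infoConst V R := by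
  have : 0 < V + R := by linarith
  unfold infoConst
  positivity

/-- The exponent one half makes the mean of the likelihood ratio under the true law a sum of
affinity terms. -/
lemma exp_half_log_sub_mul {a b : ℝ} (ha : 0 < a) (hb : 0 < b) :
    b * Real.exp ((Real.log a - Real.log b) / 2) = √(a * b) := by
  rw [← Real.log_div ha.ne' hb.ne', Real.exp_half, Real.exp_log (div_pos ha hb),
    Real.sqrt_div ha.le, Real.sqrt_mul ha.le]
  have h : √b ≠ 0 := (Real.sqrt_pos.2 hb).ne'
  field_simp
  rw [Real.sq_sqrt hb.le]

namespace DCMDP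

variable {M : DCMDP S A H}

lemma preference_apply (τ τ' : Traj S A) (y : Bool) :
    M.preference τ τ' y = ENNReal.ofReal (Real.sigmoid
      (M.ret (labelled (τ, τ') y).1 - M.ret (labelled (τ, τ') y).2)) := by
  have key : ∀ a b : ℝ, Real.exp a / (Real.exp a + Real.exp b) = Real.sigmoid (a - b) := by
    intro a b
    rw [Real.sigmoid_def, neg_sub, Real.exp_sub]
    field_simp
  rw [preference, PMF.ofFintype_apply]
  cases y
  · simp only [labelled, Bool.false_eq_true, if_false]
    rw [add_comm, key]
  · simp only [labelled, if_true]
    rw [key]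

variable {πref πstar : Policy S A} {β V R : ℝ} {Pol : Finset (Policy S A)}

/-- Zero discrepancy identifies the log-ratio gaps of `πstar` with return gaps, so labels follow its
model and the left side is a Hellinger affinity. -/
lemma eexpect_preference_likelihood_le (hβ : 0 < β) (hR0 : 0 < R) (hW : 1 ≤ V + R)
    (hR : M.BoundedReturn R) (hV : M.BoundedRatio πref Pol β V)
    (h0 : ∀ x, M.AdmissiblePair x → M.discrepancy πref β πstar x = 0)
    {π : Policy S A} (hπ : π ∈ Pol) {x : Traj S A × Traj S A} (hx : M.AdmissiblePair x) :
    eexpect (M.preference x.1 x.2) (fun y => ENNReal.ofReal (Real.exp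
      ((logLik πref β π (labelled x y) - logLik πref β πstar (labelled x y)) / 2))) ≤
      ENNReal.ofReal (1 - M.discrepancy πref β π x ^ 2 / infoConst V R) := by
  set u := β * logRatio π πref x.1 - β * logRatio π πref x.2 with hu
  set z := M.ret x.1 - M.ret x.2 with hz
  have hstar : β * logRatio πstar πref x.1 - β * logRatio πstar πref x.2 = z := by
    have := h0 x hx
    rw [discrepancy] at this
    linarith
  have hd : M.discrepancy πref β π x = u - z := by
    rw [discrepancy, hu, hz]; ring
  have hzR : |z| ≤ R := by
    have h3 := hR _ hx.fst
    have h4 := hR _ hx.snd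
    simp only [Set.mem_Icc] at h3 h4
    rw [hz, abs_le]
    constructor <;> linarith
  have hxz := abs_discrepancy_le hβ hR0 hR hV hπ hx
  rw [hd] at hxz
  have hnu : β * logRatio π πref x.2 - β * logRatio π πref x.1 = -u := by rw [hu]; ring
  have hnz : M.ret x.2 - M.ret x.1 = -z := by rw [hz]; ring
  have hns : β * logRatio πstar πref x.2 - β * logRatio πstar πref x.1 = -z := by
    rw [← hstar]; ring
  rw [eexpect, tsum_fintype, Fintype.sum_bool, preference_apply, preference_apply]
  simp only [labelled, logLik, if_true, Bool.false_eq_true, if_false]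
  rw [← hu, hstar, ← hz, hnu, hns, hnz, ← ENNReal.ofReal_mul (Real.sigmoid_nonneg _),
    ← ENNReal.ofReal_mul (Real.sigmoid_nonneg _), exp_half_log_sub_mul (Real.sigmoid_pos _)
    (Real.sigmoid_pos _), exp_half_log_sub_mul (Real.sigmoid_pos _) (Real.sigmoid_pos _),
    ← ENNReal.ofReal_add (Real.sqrt_nonneg _) (Real.sqrt_nonneg _), hd]
  exact ENNReal.ofReal_le_ofReal (sqrt_sigmoid_add_sqrt_sigmoid_le hzR hW hxz)

lemma bddOn_discrepancy_sq (hβ : 0 < β) (hR0 : 0 < R) (hR : M.BoundedReturn R)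
    (hV : M.BoundedRatio πref Pol β V) {π : Policy S A} (hπ : π ∈ Pol)
    (q : Policy S A) (ν : MixedPolicy S A) :
    BddOn (M.pairLaw q ν) fun x => M.discrepancy πref β π x ^ 2 := by
  refine ⟨(2 * (V + R)) ^ 2, fun x hx => ?_⟩
  rw [abs_pow]
  gcongr
  exact abs_discrepancy_le hβ hR0 hR hV hπ (M.admissiblePair_of_mem_support_pairLaw hx)

lemma expect_discrepancy_sq_le (hβ : 0 < β) (hR0 : 0 < R) (hR : M.BoundedReturn R)
    (hV : M.BoundedRatio πref Pol β V) {π : Policy S A} (hπ : π ∈ Pol)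
    (q : Policy S A) (ν : MixedPolicy S A) :
    expect (M.pairLaw q ν) (fun x => M.discrepancy πref β π x ^ 2) ≤ 4 * (V + R) ^ 2 := by
  refine expect_le_const (bddOn_discrepancy_sq hβ hR0 hR hV hπ q ν) fun x hx => ?_
  have h := abs_discrepancy_le hβ hR0 hR hV hπ (M.admissiblePair_of_mem_support_pairLaw hx)
  rw [← sq_abs]
  calc |M.discrepancy πref β π x| ^ 2 ≤ (2 * (V + R)) ^ 2 := by gcongr
    _ = _ := by ring

lemma eexpect_pairLaw_likelihood_le (hβ : 0 < β) (hR0 : 0 < R) (hW : 1 ≤ V + R)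
    (hR : M.BoundedReturn R) (hV : M.BoundedRatio πref Pol β V)
    (h0 : ∀ x, M.AdmissiblePair x → M.discrepancy πref β πstar x = 0)
    {π : Policy S A} (hπ : π ∈ Pol) (q : Policy S A) (ν : MixedPolicy S A) :
    eexpect (M.pairLaw q ν) (fun x => eexpect (M.preference x.1 x.2) (fun y =>
      ENNReal.ofReal (Real.exp
        ((logLik πref β π (labelled x y) - logLik πref β πstar (labelled x y)) / 2)))) ≤
      ENNReal.ofReal (Real.exp
        (-(expect (M.pairLaw q ν) (fun x => M.discrepancy πref β π x ^ 2) / infoConst V R))) := by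
  have hb := bddOn_discrepancy_sq hβ hR0 hR hV hπ q ν
  have hK := infoConst_pos hW
  have hb' : BddOn (M.pairLaw q ν)
      fun x => 1 - (infoConst V R)⁻¹ * M.discrepancy πref β π x ^ 2 :=
    (BddOn.const _ 1).sub (hb.const_mul _)
  calc _ ≤ eexpect (M.pairLaw q ν) fun x => ENNReal.ofReal
        (1 - (infoConst V R)⁻¹ * M.discrepancy πref β π x ^ 2) := by
        refine eexpect_mono fun x hx => ?_
        refine (eexpect_preference_likelihood_le hβ hR0 hW hR hV h0 hπ
          (M.admissiblePair_of_mem_support_pairLaw hx)).trans_eq ?_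
        rw [div_eq_inv_mul]
    _ = ENNReal.ofReal (1 - (infoConst V R)⁻¹ *
          expect (M.pairLaw q ν) fun x => M.discrepancy πref β π x ^ 2) := by
        rw [eexpect_ofReal hb', expect_sub (BddOn.const _ 1) (hb.const_mul _), expect_const,
          expect_const_mul]
        -- Nonnegativity, needed to move `ENNReal.ofReal` through the mean, holds because `4(V+R)² ≤
        -- infoConst V R`.
        intro x hx
        have h := abs_discrepancy_le hβ hR0 hR hV hπ (M.admissiblePair_of_mem_support_pairLaw hx)
        rw [sub_nonneg, ← div_eq_inv_mul, div_le_one hK, ← sq_abs]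
        calc |M.discrepancy πref β π x| ^ 2 ≤ (2 * (V + R)) ^ 2 := by gcongr
          _ ≤ 576 * (V + R) ^ 2 * 1 := by nlinarith [sq_nonneg (V + R)]
          _ ≤ _ := by
              unfold infoConst
              gcongr
              exact Real.one_le_exp (by linarith)
    _ ≤ _ := by
        refine ENNReal.ofReal_le_ofReal ?_
        rw [div_eq_inv_mul]
        linarith [Real.add_one_le_exp (-((infoConst V R)⁻¹ *
          expect (M.pairLaw q ν) fun x => M.discrepancy πref β π x ^ 2))]

end DCMDP

end Likelihood

section Algorithm

variable {S A : Type*} {H : ℕ}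

/-! ### The trajectory of the algorithm -/

/-- The sampling policy of the algorithm after `n` policies `p 0, …, p (n - 1)` have been chosen;
the first one is always `π_ref`. -/
def sampSeq (πref : Policy S A) (samp : Strategy S A) (p : ℕ → Policy S A) (n : ℕ) :
    MixedPolicy S A :=
  -- The first sampler is `πref` whatever `samp [πref]` is; the value at `0` is a convention.
  if n ≤ 1 then PMF.pure πref else samp ((List.range n).map p)

/-- The cumulative in-sample squared discrepancy of `π` over the first `n` iterations. -/
def cumSq (M : DCMDP S A H) (πref : Policy S A) (β : ℝ) (samp : Strategy S A) (p : ℕ → Policy S A)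
    (n : ℕ) (π : Policy S A) : ℝ :=
  ∑ i ∈ Finset.range n, expect (M.pairLaw (p i) (sampSeq πref samp p (i + 1)))
    fun x => M.discrepancy πref β π x ^ 2

lemma sampSeq_congr (πref : Policy S A) (samp : Strategy S A) {p p' : ℕ → Policy S A} {n : ℕ}
    (h : ∀ i < n, p i = p' i) : sampSeq πref samp p n = sampSeq πref samp p' n := by
  have : (List.range n).map p = (List.range n).map p' :=
    List.map_congr_left fun i hi => h i (List.mem_range.1 hi)
  rw [sampSeq, sampSeq, this]

lemma cumSq_congr (M : DCMDP S A H) (πref : Policy S A) (β : ℝ) (samp : Strategy S A)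
    {p p' : ℕ → Policy S A} {n : ℕ} (h : ∀ i < n, p i = p' i) (π : Policy S A) :
    cumSq M πref β samp p n π = cumSq M πref β samp p' n π := by
  refine Finset.sum_congr rfl fun i hi => ?_
  have hi' := Finset.mem_range.1 hi
  rw [h i hi', sampSeq_congr πref samp fun j hj => h j (by omega)]

/-! ### The chosen policies as an indexed sequence -/

namespace State

/-- The chosen policies as a sequence, continued by the default value `d`. -/
def seq (d : Policy S A) (st : State S A) (i : ℕ) : Policy S A := st.policies.getD i d

/-- The state after an iteration with responses `x`, label `y` and optimism data `opt`. -/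
def advance (samp : Strategy S A) (sel : Selector S A) (st : State S A)
    (x : Traj S A × Traj S A) (y : Bool) (opt : List (Traj S A)) : State S A :=
  let prefs := st.prefs ++ [labelled x y]
  let new := sel st prefs opt
  { past := st.policies
    cur := new
    sampler := samp (st.policies ++ [new])
    prefs := prefs
    seconds := st.seconds ++ [x.2] }

variable {samp : Strategy S A} {sel : Selector S A} {d : Policy S A} {st : State S A}
  {x : Traj S A × Traj S A} {y : Bool} {opt : List (Traj S A)}

lemma seq_advance_of_le {i : ℕ} (hi : i ≤ st.past.length) :
    (st.advance samp sel x y opt).seq d i = st.seq d i := by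
  have h : i < st.policies.length := by simp [policies]; omega
  simp only [seq]
  exact List.getD_append _ _ _ _ h

lemma seq_past_length : st.seq d st.past.length = st.cur := by
  simp [seq, policies]

lemma seq_advance_succ :
    (st.advance samp sel x y opt).seq d (st.past.length + 1) =
      sel st (st.prefs ++ [labelled x y]) opt := by
  have h : (st.advance samp sel x y opt).past.length = st.past.length + 1 := by
    simp [advance, policies]
  rw [← h, seq_past_length]
  rfl

lemma seq_of_lt {i : ℕ} (hi : st.past.length < i) : st.seq d i = d := by
  have h : st.policies.length ≤ i := by simp [policies]; omega
  exact List.getD_eq_default _ _ h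

lemma policies_eq_map_seq : st.policies = (List.range (st.past.length + 1)).map (st.seq d) := by
  have hl : st.policies.length = st.past.length + 1 := by simp [policies]
  refine List.ext_getElem (by simp [hl]) fun i h1 h2 => ?_
  simp [seq, List.getElem?_eq_getElem h1]

end State

/-- One iteration, with the two responses drawn jointly. -/
lemma step_eq (M : DCMDP S A H) (samp : Strategy S A) (sel : Selector S A)
    (draw : MixedPolicy S A → List (Traj S A) → PMF (List (Traj S A))) (st : State S A) :
    step M samp sel draw st = (M.pairLaw st.cur st.sampler).bind fun x =>
      (M.preference x.1 x.2).bind fun y =>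
        (draw st.sampler (st.seconds ++ [x.2])).map fun opt => st.advance samp sel x y opt := by
  simp only [step, DCMDP.pairLaw, PMF.bind_bind, PMF.bind_map]
  rfl

lemma eexpect_step (M : DCMDP S A H) (samp : Strategy S A) (sel : Selector S A)
    (draw : MixedPolicy S A → List (Traj S A) → PMF (List (Traj S A))) (st : State S A)
    (F : State S A → ℝ≥0∞) :
    eexpect (step M samp sel draw st) F =
      eexpect (M.pairLaw st.cur st.sampler) fun x =>
        eexpect (M.preference x.1 x.2) fun y =>
          eexpect (draw st.sampler (st.seconds ++ [x.2])) fun opt =>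
            F (st.advance samp sel x y opt) := by
  simp only [step_eq, eexpect_bind, eexpect_map]

/-- Standing assumptions: bounded returns and density ratios, and a comparator in the class whose
discrepancy vanishes. -/
structure Regular (M : DCMDP S A H) (πref : Policy S A) (Pol : Finset (Policy S A)) (β V R : ℝ)
    (πstar : Policy S A) : Prop where
  beta_pos : 0 < β
  R_pos : 0 < R
  one_le : 1 ≤ V + R
  ret : M.BoundedReturn R
  ratio : M.BoundedRatio πref Pol β V
  mem : πstar ∈ Pol
  disc : ∀ x, M.AdmissiblePair x → M.discrepancy πref β πstar x = 0

/-- Properties of every state reached after `n` iterations. -/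
structure Reached (M : DCMDP S A H) (πref : Policy S A) (Pol : Finset (Policy S A))
    (samp : Strategy S A) (d : Policy S A) (n : ℕ) (st : State S A) : Prop where
  past_length : st.past.length = n
  seconds_length : st.seconds.length = n
  sampler : st.sampler = sampSeq πref samp (st.seq d) (n + 1)
  seq_zero : st.seq d 0 = πref
  seq_mem : ∀ i, 1 ≤ i → st.seq d i ∈ Pol
  seconds : ∀ τ ∈ st.seconds, M.Admissible τ

section Run

variable {M : DCMDP S A H} {πref d : Policy S A} {Pol : Finset (Policy S A)} {samp : Strategy S A}
  {sel : Selector S A} {draw : MixedPolicy S A → List (Traj S A) → PMF (List (Traj S A))}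
  {β α V R : ℝ}

lemma Reached.advance {n : ℕ} {st : State S A} (h : Reached M πref Pol samp d n st) (hd : d ∈ Pol)
    (hsel : IsArgmin πref Pol β α sel) {x : Traj S A × Traj S A} (hx : M.AdmissiblePair x)
    (y : Bool) (opt : List (Traj S A)) :
    Reached M πref Pol samp d (n + 1) (st.advance samp sel x y opt) := by
  have hpl : (st.advance samp sel x y opt).past.length = n + 1 := by
    simp [State.advance, State.policies, h.past_length]
  refine ⟨hpl, ?_, ?_, ?_, ?_, ?_⟩
  · simp [State.advance, h.seconds_length]
  · rw [sampSeq, if_neg (by omega)]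
    have := State.policies_eq_map_seq (d := d) (st := st.advance samp sel x y opt)
    rw [hpl] at this
    rw [← this]
    rfl
  · rw [State.seq_advance_of_le (Nat.zero_le _), h.seq_zero]
  · intro i hi
    rcases lt_trichotomy i (st.past.length + 1) with h1 | h1 | h1
    · rw [State.seq_advance_of_le (by omega)]
      exact h.seq_mem i hi
    · rw [h1, State.seq_advance_succ]
      exact (hsel _ _ _).1
    -- Padding with a member of the class keeps the sequence eligible for the SEC supremum.
    · rw [State.seq_of_lt (by rw [hpl, ← h.past_length]; exact h1)]
      exact hd
  · intro τ hτ
    simp only [State.advance, List.mem_append, List.mem_singleton] at hτ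
    rcases hτ with hτ | rfl
    · exact h.seconds τ hτ
    · exact hx.snd

lemma reached_of_mem_support_run (hd : d ∈ Pol) (hsel : IsArgmin πref Pol β α sel) (n : ℕ)
    (st : State S A) (hst : st ∈ (run M πref samp sel draw n).support) :
    Reached M πref Pol samp d n st := by
  induction n generalizing st with
  | zero =>
    simp only [run, PMF.mem_support_pure_iff] at hst
    subst hst
    refine ⟨rfl, rfl, ?_, ?_, ?_, ?_⟩
    · simp [sampSeq]
    · simp [State.seq, State.policies]
    · intro i hi
      rw [State.seq_of_lt (show 0 < i from hi)]
      exact hd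
    · simp
  | succ n ih =>
    simp only [run, PMF.mem_support_bind_iff, step_eq, PMF.mem_support_map_iff] at hst
    obtain ⟨st', h1, x, hx, y, -, opt, -, rfl⟩ := hst
    exact (ih st' h1).advance hd hsel (M.admissiblePair_of_mem_support_pairLaw hx) y opt

/-! ### Likelihood process -/

/-- The exponential process that controls the in-sample error of `π` by its likelihood. -/
def likProcess (M : DCMDP S A H) (πref : Policy S A) (β V R : ℝ) (samp : Strategy S A)
    (πstar π : Policy S A) (st : State S A) : ℝ≥0∞ :=
  ENNReal.ofReal (Real.exp
    (((st.prefs.map (logLik πref β π)).sum - (st.prefs.map (logLik πref β πstar)).sum) / 2 +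
      cumSq M πref β samp (st.seq πstar) st.past.length π / infoConst V R))

variable {πstar π : Policy S A}

lemma likProcess_advance {n : ℕ} {st : State S A} (h : Reached M πref Pol samp πstar n st)
    (x : Traj S A × Traj S A) (y : Bool) (opt : List (Traj S A)) :
    likProcess M πref β V R samp πstar π (st.advance samp sel x y opt) =
      likProcess M πref β V R samp πstar π st *
        ENNReal.ofReal (Real.exp (expect (M.pairLaw st.cur st.sampler)
          (fun x => M.discrepancy πref β π x ^ 2) / infoConst V R)) *
        ENNReal.ofReal (Real.exp
          ((logLik πref β π (labelled x y) - logLik πref β πstar (labelled x y)) / 2)) := by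
  have h1 : cumSq M πref β samp ((st.advance samp sel x y opt).seq πstar)
      (st.advance samp sel x y opt).past.length π =
      cumSq M πref β samp (st.seq πstar) st.past.length π + expect (M.pairLaw st.cur st.sampler)
          (fun x => M.discrepancy πref β π x ^ 2) := by
    have hpl : (st.advance samp sel x y opt).past.length = st.past.length + 1 := by
      simp [State.advance, State.policies]
    rw [hpl, cumSq_congr M πref β samp (p' := st.seq πstar) fun i hi =>
      State.seq_advance_of_le (by omega), cumSq, Finset.sum_range_succ, ← cumSq,
      State.seq_past_length, h.past_length, h.sampler]
  have h2 : (st.advance samp sel x y opt).prefs = st.prefs ++ [labelled x y] := rfl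
  rw [likProcess, likProcess, h1, h2, ← ENNReal.ofReal_mul (Real.exp_pos _).le,
    ← ENNReal.ofReal_mul (by positivity), ← Real.exp_add, ← Real.exp_add]
  congr 2
  simp only [List.map_append, List.map_cons, List.map_nil, List.sum_append, List.sum_cons,
    List.sum_nil]
  ring

/-- Supermartingale step: given the state, the increment of `cumSq` is deterministic, and its
exponential is the inverse of the bound on the mean likelihood factor. -/
lemma eexpect_likProcess_advance_le (hreg : Regular M πref Pol β V R πstar) (hπ : π ∈ Pol)
    {n : ℕ} {st : State S A} (h : Reached M πref Pol samp πstar n st) (opt : List (Traj S A)) :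
    eexpect (M.pairLaw st.cur st.sampler) (fun x => eexpect (M.preference x.1 x.2) fun y =>
      likProcess M πref β V R samp πstar π (st.advance samp sel x y opt)) ≤
      likProcess M πref β V R samp πstar π st := by
  simp only [likProcess_advance h, eexpect_const_mul]
  rw [mul_assoc]
  refine mul_le_of_le_one_right' ?_
  refine (mul_le_mul_right (DCMDP.eexpect_pairLaw_likelihood_le hreg.beta_pos hreg.R_pos hreg.one_le
    hreg.ret hreg.ratio hreg.disc hπ _ _) _).trans_eq ?_
  rw [← ENNReal.ofReal_mul (Real.exp_pos _).le, ← Real.exp_add, add_neg_cancel, Real.exp_zero,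
    ENNReal.ofReal_one]

/-- The optimism data influence only the newly chosen policy, which `cumSq` does not yet use for
sampling. -/
lemma likProcess_advance_congr (x : Traj S A × Traj S A) (y : Bool) (opt opt' : List (Traj S A))
    {n : ℕ} {st : State S A} (h : Reached M πref Pol samp πstar n st) :
    likProcess M πref β V R samp πstar π (st.advance samp sel x y opt) =
      likProcess M πref β V R samp πstar π (st.advance samp sel x y opt') := by
  rw [likProcess_advance h, likProcess_advance h]

lemma eexpect_run_likProcess_le (hreg : Regular M πref Pol β V R πstar)
    (hsel : IsArgmin πref Pol β α sel) (hπ : π ∈ Pol) (n : ℕ) :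
    eexpect (run M πref samp sel draw n) (likProcess M πref β V R samp πstar π) ≤ 1 := by
  induction n with
  | zero => simp [run, likProcess, cumSq]
  | succ n ih =>
    rw [run, eexpect_bind]
    refine le_trans (eexpect_mono fun st hst => ?_) ih
    have h := reached_of_mem_support_run hreg.mem hsel n st hst
    rw [eexpect_step]
    refine le_trans (eexpect_mono fun x _ => eexpect_mono fun y _ => ?_)
      (eexpect_likProcess_advance_le hreg hπ h (sel := sel) [])
    exact eexpect_le_const fun opt _ => (likProcess_advance_congr x y opt [] h).le

end Run

end Algorithm

section Concentration

variable {S A : Type*} {H : ℕ}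

section Run

variable {M : DCMDP S A H} {πref : Policy S A} {Pol : Finset (Policy S A)} {samp : Strategy S A}
  {sel : Selector S A} {draw : MixedPolicy S A → List (Traj S A) → PMF (List (Traj S A))}
  {β α V R : ℝ} {πstar π : Policy S A}

/-! ### Deviation of the optimism data -/

/-- The exponential deviation of the optimism data from its mean. -/
def optDeviation (M : DCMDP S A H) (πref : Policy S A) (β V R : ℝ) (πstar π : Policy S A) (l : ℝ)
    (ν : MixedPolicy S A) (opt : List (Traj S A)) : ℝ≥0∞ :=
  ENNReal.ofReal (Real.exp
    (l * (opt.length * expect (M.trajLaw ν) (DCMDP.ratioGap πref β π πstar) -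
      (opt.map (DCMDP.ratioGap πref β π πstar)).sum) - opt.length * (2 * l ^ 2 * (V + R) ^ 2)))

lemma optDeviation_nil (l : ℝ) (ν : MixedPolicy S A) :
    optDeviation M πref β V R πstar π l ν [] = 1 := by
  simp [optDeviation]

lemma optDeviation_append (l : ℝ) (ν : MixedPolicy S A) (opt opt' : List (Traj S A)) :
    optDeviation M πref β V R πstar π l ν (opt ++ opt') =
      optDeviation M πref β V R πstar π l ν opt * optDeviation M πref β V R πstar π l ν opt' := by
  rw [optDeviation, optDeviation, optDeviation, ← ENNReal.ofReal_mul (Real.exp_pos _).le,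
    ← Real.exp_add]
  congr 2
  simp only [List.length_append, List.map_append, List.sum_append]
  push_cast
  ring

lemma eexpect_optDeviation_singleton_le (hreg : Regular M πref Pol β V R πstar) (hπ : π ∈ Pol)
    (l : ℝ) (ν : MixedPolicy S A) :
    eexpect (M.trajLaw ν) (fun τ => optDeviation M πref β V R πstar π l ν [τ]) ≤ 1 := by
  have hB : ∀ τ ∈ (M.trajLaw ν).support, |DCMDP.ratioGap πref β π πstar τ| ≤ 2 * (V + R) := by
    intro τ hτ
    have := DCMDP.abs_ratioGap_le hreg.beta_pos hreg.ratio hπ hreg.mem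
      (M.admissible_of_mem_support_trajLaw hτ)
    linarith [hreg.R_pos]
  -- The bound `2(V+R)` gives Hoeffding's exponent `2 l² (V+R)²`, the compensator per sample in
  -- `optDeviation`.
  have h := eexpect_exp_le hB l
  calc _ = eexpect (M.trajLaw ν) fun τ => ENNReal.ofReal (Real.exp (-(2 * l ^ 2 * (V + R) ^ 2))) *
        ENNReal.ofReal (Real.exp (l * (expect (M.trajLaw ν) (DCMDP.ratioGap πref β π πstar) -
          DCMDP.ratioGap πref β π πstar τ))) := by
        refine eexpect_congr fun τ _ => ?_
        rw [optDeviation, ← ENNReal.ofReal_mul (Real.exp_pos _).le, ← Real.exp_add]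
        congr 2
        simp
        ring
    _ ≤ ENNReal.ofReal (Real.exp (-(2 * l ^ 2 * (V + R) ^ 2))) *
          ENNReal.ofReal (Real.exp (l ^ 2 * (2 * (V + R)) ^ 2 / 2)) := by
        rw [eexpect_const_mul]
        gcongr
    _ = 1 := by
        rw [← ENNReal.ofReal_mul (Real.exp_pos _).le, ← Real.exp_add, ← ENNReal.ofReal_one,
          ← Real.exp_zero]
        congr 2
        ring

lemma eexpect_iid_optDeviation_le (hreg : Regular M πref Pol β V R πstar) (hπ : π ∈ Pol)
    (l : ℝ) (ν : MixedPolicy S A) (n : ℕ) :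
    eexpect (iid (M.trajLaw ν) n) (optDeviation M πref β V R πstar π l ν) ≤ 1 := by
  induction n with
  | zero => simp [iid, optDeviation_nil]
  | succ n ih =>
    rw [iid, eexpect_bind]
    refine le_trans (eexpect_mono fun τ _ => ?_) (eexpect_optDeviation_singleton_le hreg hπ l ν)
    rw [eexpect_map]
    have h : ∀ opt, optDeviation M πref β V R πstar π l ν (τ :: opt) =
        optDeviation M πref β V R πstar π l ν [τ] * optDeviation M πref β V R πstar π l ν opt :=
      fun opt => optDeviation_append l ν [τ] opt
    rw [eexpect_congr fun opt _ => h opt, eexpect_const_mul]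
    exact mul_le_of_le_one_right' ih

lemma mem_support_iid {X : Type*} {p : PMF X} {n : ℕ} {l : List X} (h : l ∈ (iid p n).support) :
    l.length = n ∧ ∀ x ∈ l, x ∈ p.support := by
  induction n generalizing l with
  | zero =>
    simp only [iid, PMF.mem_support_pure_iff] at h
    simp [h]
  | succ n ih =>
    simp only [iid, PMF.mem_support_bind_iff, PMF.mem_support_map_iff] at h
    obtain ⟨x, hx, l, hl, rfl⟩ := h
    obtain ⟨h1, h2⟩ := ih hl
    refine ⟨by simp [h1], fun z hz => ?_⟩
    rcases List.mem_cons.1 hz with rfl | hz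
    · exact hx
    · exact h2 z hz

/-- The optimism data consists of one admissible trajectory per iteration and concentrates. -/
structure Concentrates (M : DCMDP S A H) (πref : Policy S A) (Pol : Finset (Policy S A))
    (β V R : ℝ) (πstar : Policy S A) (samp : Strategy S A) (sel : Selector S A)
    (draw : MixedPolicy S A → List (Traj S A) → PMF (List (Traj S A))) : Prop where
  admissible : ∀ ν l, (∀ τ ∈ l, M.Admissible τ) → ∀ opt ∈ (draw ν l).support,
    opt.length = l.length ∧ ∀ τ ∈ opt, M.Admissible τ
  -- The mean is over the whole run because plain XPO reuses its earlier responses, which are not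
  -- fresh given the state.
  deviation : ∀ n, ∀ π ∈ Pol, ∀ l, eexpect (run M πref samp sel draw n) (fun st =>
    eexpect (M.pairLaw st.cur st.sampler) fun x =>
      eexpect (draw st.sampler (st.seconds ++ [x.2]))
        (optDeviation M πref β V R πstar π l st.sampler)) ≤ 1

lemma concentrates_iid (hreg : Regular M πref Pol β V R πstar) :
    Concentrates M πref Pol β V R πstar samp sel
      (fun ν seconds => iid (M.trajLaw ν) seconds.length) where
  admissible ν l _ opt hopt := by
    obtain ⟨h1, h2⟩ := mem_support_iid hopt
    exact ⟨h1, fun τ hτ => M.admissible_of_mem_support_trajLaw (h2 τ hτ)⟩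
  deviation n π hπ l := eexpect_le_const fun st _ => eexpect_le_const fun x _ =>
    eexpect_iid_optDeviation_le hreg hπ l _ _

lemma sampSeq_refStrategy (πref : Policy S A) (p : ℕ → Policy S A) (n : ℕ) :
    sampSeq πref (refStrategy πref) p n = PMF.pure πref := by
  simp [sampSeq, refStrategy]

lemma eexpect_pairLaw_optDeviation_append_le (hreg : Regular M πref Pol β V R πstar)
    (hπ : π ∈ Pol) (l : ℝ) (q : Policy S A) (ν : MixedPolicy S A) (opt : List (Traj S A)) :
    eexpect (M.pairLaw q ν) (fun x => optDeviation M πref β V R πstar π l ν (opt ++ [x.2])) ≤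
      optDeviation M πref β V R πstar π l ν opt := by
  simp only [optDeviation_append l ν opt, eexpect_const_mul]
  refine mul_le_of_le_one_right' ?_
  have h := eexpect_optDeviation_singleton_le hreg hπ l ν
  rwa [← M.pairLaw_map_snd q ν, eexpect_map] at h

/-- Although the policies depend on the earlier responses, each new one is drawn from the same
`πref` law given the past, so the deviation of the whole list is a supermartingale. -/
lemma concentrates_seconds (hreg : Regular M πref Pol β V R πstar)
    (hsel : IsArgmin πref Pol β α sel) :
    Concentrates M πref Pol β V R πstar (refStrategy πref) sel
      (fun _ seconds => PMF.pure seconds) where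
  admissible ν l hl opt hopt := by
    rw [PMF.mem_support_pure_iff] at hopt
    subst hopt
    exact ⟨rfl, hl⟩
  deviation n π hπ l := by
    have hsampler : ∀ n, ∀ st ∈ (run M πref (refStrategy πref) sel
        (fun _ seconds => PMF.pure seconds) n).support, st.sampler = PMF.pure πref := by
      intro n st hst
      rw [(reached_of_mem_support_run hreg.mem hsel n st hst).sampler, sampSeq_refStrategy]
    have hrun : ∀ n, eexpect (run M πref (refStrategy πref) sel
        (fun _ seconds => PMF.pure seconds) n) (fun st =>
          optDeviation M πref β V R πstar π l (PMF.pure πref) st.seconds) ≤ 1 := by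
      intro n
      induction n with
      | zero => simp [run, optDeviation_nil]
      | succ n ih =>
        rw [run, eexpect_bind]
        refine le_trans (eexpect_mono fun st hst => ?_) ih
        rw [eexpect_step, hsampler n st hst]
        refine le_trans (eexpect_mono fun x _ => ?_)
          (eexpect_pairLaw_optDeviation_append_le hreg hπ l st.cur (PMF.pure πref) st.seconds)
        simp [State.advance]
    refine le_trans (eexpect_mono fun st hst => ?_) (hrun n)
    rw [hsampler n st hst]
    simp only [eexpect_pure]
    exact eexpect_pairLaw_optDeviation_append_le hreg hπ l _ _ _

/-! ### The high-probability event -/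

/-- The regret bound that the algorithm satisfies at the policy `p n`. -/
def RegretEvent (M : DCMDP S A H) (πref : Policy S A) (β V R α ℓ : ℝ) (samp : Strategy S A)
    (πstar : Policy S A) (p : ℕ → Policy S A) (n : ℕ) : Prop :=
  M.J πref β πstar - M.J πref β (p n) ≤
    expect (M.pairLaw (p n) (sampSeq πref samp p n)) (M.discrepancy πref β (p n)) +
      β / (α * n) * (4 * ℓ - 2 * (cumSq M πref β samp p n (p n) / infoConst V R)) +
      4 * (V + R) * √(ℓ / n)

lemma regretEvent_congr {ℓ : ℝ} {p p' : ℕ → Policy S A} {n : ℕ} (h : ∀ i ≤ n, p i = p' i) :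
    RegretEvent M πref β V R α ℓ samp πstar p n ↔
      RegretEvent M πref β V R α ℓ samp πstar p' n := by
  rw [RegretEvent, RegretEvent, h n le_rfl, sampSeq_congr πref samp fun i hi => h i hi.le,
    cumSq_congr M πref β samp fun i hi => h i hi.le]

/-- Here `m` is the mean of `ratioGap`, `X` its empirical sum, `D` the log-likelihood gap and `Q`
the in-sample error. The parameter `√(ℓ/n)/W` makes the compensator exactly `2ℓ`, so `n m - X ≤ 4 n
W √(ℓ/n)`, while minimality gives `α X / β ≤ D ≤ 4ℓ - 2Q/K`. -/
lemma mean_le_of_deviation_le {α β W ℓ K D Q X m : ℝ} {n : ℕ} (hn : 1 ≤ n) (hα : 0 < α)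
    (hβ : 0 < β) (hW : 0 < W) (hℓ : 0 < ℓ) (hD : D / 2 + Q / K ≤ 2 * ℓ)
    (hX : √(ℓ / n) / W * (n * m - X) - n * (2 * (√(ℓ / n) / W) ^ 2 * W ^ 2) ≤ 2 * ℓ)
    (harg : α * (X / β) ≤ D) :
    m ≤ β / (α * n) * (4 * ℓ - 2 * (Q / K)) + 4 * W * √(ℓ / n) := by
  have hn0 : (0 : ℝ) < n := by exact_mod_cast hn
  set s := √(ℓ / n) with hs
  have hs0 : 0 < s := Real.sqrt_pos.2 (div_pos hℓ hn0)
  have hss : n * s ^ 2 = ℓ := by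
    rw [hs, Real.sq_sqrt (div_pos hℓ hn0).le]
    field_simp
  have h1 : n * m - X ≤ n * (4 * W * s) := by
    have e : n * (2 * (s / W) ^ 2 * W ^ 2) = 2 * ℓ := by
      rw [← hss]
      field_simp
    rw [e] at hX
    have h2 : s / W * (n * m - X) ≤ s / W * (n * (4 * W * s)) := by
      have e2 : s / W * (n * (4 * W * s)) = 4 * ℓ := by
        rw [← hss]
        field_simp
      rw [e2]
      linarith
    exact le_of_mul_le_mul_left h2 (div_pos hs0 hW)
  have h2 : X ≤ β / α * (4 * ℓ - 2 * (Q / K)) := by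
    have h3 : α * (X / β) ≤ 4 * ℓ - 2 * (Q / K) := by linarith
    calc X = β / α * (α * (X / β)) := by field_simp
      _ ≤ _ := by gcongr
  have h4 : n * m ≤ n * (β / (α * n) * (4 * ℓ - 2 * (Q / K)) + 4 * W * s) := by
    have e : n * (β / (α * n) * (4 * ℓ - 2 * (Q / K)) + 4 * W * s) =
        β / α * (4 * ℓ - 2 * (Q / K)) + n * (4 * W * s) := by
      field_simp
    rw [e]
    linarith
  exact le_of_mul_le_mul_left h4 hn0

lemma sum_ratioGap (hreg : Regular M πref Pol β V R πstar) (hπ : π ∈ Pol)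
    {opt : List (Traj S A)} (hopt : ∀ τ ∈ opt, M.Admissible τ) :
    (opt.map (DCMDP.ratioGap πref β π πstar)).sum / β =
      (opt.map fun τ => Real.log (polProb π τ)).sum -
        (opt.map fun τ => Real.log (polProb πstar τ)).sum := by
  have hβ := hreg.beta_pos
  induction opt with
  | nil => simp
  | cons τ opt ih =>
    have h1 := DCMDP.log_polProb_sub hreg.ratio hπ hreg.mem (hopt τ (by simp))
    have h2 := ih fun τ' hτ' => hopt τ' (by simp [hτ'])
    have h3 : DCMDP.ratioGap πref β π πstar τ / β =
        logRatio π πref τ - logRatio πstar πref τ := by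
      rw [DCMDP.ratioGap]
      field_simp
    simp only [List.map_cons, List.sum_cons, add_div]
    linarith

lemma ofReal_exp_le_of_not_le {a b : ℝ} (h : ¬ a ≤ b) :
    ENNReal.ofReal (Real.exp b) ≤ ENNReal.ofReal (Real.exp a) :=
  ENNReal.ofReal_le_ofReal (Real.exp_le_exp.2 (not_le.1 h).le)

/-- If the regret bound fails after an iteration, one of the exponential processes is large. -/
lemma one_le_of_not_regretEvent (hreg : Regular M πref Pol β V R πstar)
    (hsel : IsArgmin πref Pol β α sel) {ℓ : ℝ} (hα : 0 < α) (hℓ : 0 < ℓ)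
    {n : ℕ} {st : State S A} (h : Reached M πref Pol samp πstar n st)
    (x : Traj S A × Traj S A) (y : Bool) {opt : List (Traj S A)} (hlen : opt.length = n + 1)
    (hopt : ∀ τ ∈ opt, M.Admissible τ)
    (hbad : ¬ RegretEvent M πref β V R α ℓ samp πstar
      ((st.advance samp sel x y opt).seq πstar) (n + 1)) :
    1 ≤ ENNReal.ofReal (Real.exp (-(2 * ℓ))) * ∑ π ∈ Pol,
      (likProcess M πref β V R samp πstar π (st.advance samp sel x y opt) +
        optDeviation M πref β V R πstar π (√(ℓ / (n + 1 : ℕ)) / (V + R)) st.sampler opt) := by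
  have hW : 0 < V + R := by linarith [hreg.one_le]
  set st' := st.advance samp sel x y opt with hst'
  set π := sel st (st.prefs ++ [labelled x y]) opt with hπdef
  have hπ : π ∈ Pol := (hsel _ _ _).1
  have hseq : st'.seq πstar (n + 1) = π := by
    rw [← h.past_length]
    exact State.seq_advance_succ
  have hsamp : sampSeq πref samp (st'.seq πstar) (n + 1) = st.sampler := by
    rw [h.sampler]
    refine sampSeq_congr πref samp fun i hi => State.seq_advance_of_le ?_
    rw [h.past_length]
    omega
  have hpl : st'.past.length = n + 1 := by
    simp [hst', State.advance, State.policies, h.past_length]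
  -- The minimizer depends on the data, so its processes are dominated by the sum over the class.
  suffices hlarge : ENNReal.ofReal (Real.exp (2 * ℓ)) ≤
      likProcess M πref β V R samp πstar π st' +
        optDeviation M πref β V R πstar π (√(ℓ / (n + 1 : ℕ)) / (V + R)) st.sampler opt by
    calc (1 : ℝ≥0∞) = ENNReal.ofReal (Real.exp (-(2 * ℓ))) * ENNReal.ofReal (Real.exp (2 * ℓ)) := by
          rw [← ENNReal.ofReal_mul (Real.exp_pos _).le, ← Real.exp_add, neg_add_cancel,
            Real.exp_zero, ENNReal.ofReal_one]
      _ ≤ _ := by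
          gcongr
          exact hlarge.trans (Finset.single_le_sum
            (f := fun π => likProcess M πref β V R samp πstar π st' +
              optDeviation M πref β V R πstar π (√(ℓ / (n + 1 : ℕ)) / (V + R)) st.sampler opt)
            (fun _ _ => zero_le) hπ)
  by_contra hsmall
  refine hbad ?_
  have h1 : ((st'.prefs.map (logLik πref β π)).sum - (st'.prefs.map (logLik πref β πstar)).sum) / 2 +
      cumSq M πref β samp (st'.seq πstar) (n + 1) π / infoConst V R ≤ 2 * ℓ := by
    by_contra hc
    refine hsmall (le_trans (ofReal_exp_le_of_not_le hc) (le_trans (le_of_eq ?_) le_self_add))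
    rw [likProcess, hpl]
  have h2 : √(ℓ / (n + 1 : ℕ)) / (V + R) * ((n + 1 : ℕ) *
      expect (M.trajLaw st.sampler) (DCMDP.ratioGap πref β π πstar) -
      (opt.map (DCMDP.ratioGap πref β π πstar)).sum) -
        (n + 1 : ℕ) * (2 * (√(ℓ / (n + 1 : ℕ)) / (V + R)) ^ 2 * (V + R) ^ 2) ≤ 2 * ℓ := by
    by_contra hc
    refine hsmall (le_trans (ofReal_exp_le_of_not_le hc) (le_trans (le_of_eq ?_) le_add_self))
    rw [optDeviation, hlen]
  have harg : α * ((opt.map (DCMDP.ratioGap πref β π πstar)).sum / β) ≤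
      (st'.prefs.map (logLik πref β π)).sum - (st'.prefs.map (logLik πref β πstar)).sum := by
    have h3 := (hsel st (st.prefs ++ [labelled x y]) opt).2 πstar hreg.mem
    rw [← hπdef, objective, objective] at h3
    rw [sum_ratioGap hreg hπ hopt, mul_sub]
    have e : ∀ π, (st'.prefs.map (logLik πref β π)).sum =
      ((st.prefs ++ [labelled x y]).map fun x => Real.log (Real.sigmoid
        (β * logRatio π πref x.1 - β * logRatio π πref x.2))).sum := fun π => rfl
    rw [e, e]
    linarith
  have hmean := mean_le_of_deviation_le (Nat.le_add_left 1 n) hα hreg.beta_pos hW hℓ h1 h2 harg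
  rw [RegretEvent, hseq, hsamp,
    DCMDP.J_sub_J_eq hreg.beta_pos hreg.ret hreg.ratio hπ hreg.mem hreg.disc st.sampler]
  linarith

lemma toOuterMeasure_not_regretEvent_le (hreg : Regular M πref Pol β V R πstar)
    (hsel : IsArgmin πref Pol β α sel) (hc : Concentrates M πref Pol β V R πstar samp sel draw)
    {ℓ : ℝ} (hα : 0 < α) (hℓ : 0 < ℓ) (n : ℕ) :
    (run M πref samp sel draw (n + 1)).toOuterMeasure
      {st | ¬ RegretEvent M πref β V R α ℓ samp πstar (st.seq πstar) (n + 1)} ≤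
      ENNReal.ofReal (Real.exp (-(2 * ℓ))) * (2 * Pol.card) := by
  set l := √(ℓ / (n + 1 : ℕ)) / (V + R) with hl
  rw [toOuterMeasure_eq_eexpect, run, eexpect_bind]
  -- Markov's inequality in pointwise form. Replacing `opt` by `[]` in `likProcess` changes nothing
  -- and separates the two expectations.
  calc _ ≤ eexpect (run M πref samp sel draw n) (fun st =>
        eexpect (M.pairLaw st.cur st.sampler) fun x =>
          eexpect (M.preference x.1 x.2) fun y =>
            eexpect (draw st.sampler (st.seconds ++ [x.2])) fun opt =>
              ENNReal.ofReal (Real.exp (-(2 * ℓ))) * ∑ π ∈ Pol,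
                (likProcess M πref β V R samp πstar π (st.advance samp sel x y []) +
                  optDeviation M πref β V R πstar π l st.sampler opt)) := by
        refine eexpect_mono fun st hst => ?_
        have h := reached_of_mem_support_run hreg.mem hsel n st hst
        rw [eexpect_step]
        refine eexpect_mono fun x hx => eexpect_mono fun y _ => eexpect_mono fun opt hopt => ?_
        have hx' := M.admissiblePair_of_mem_support_pairLaw hx
        obtain ⟨h1, h2⟩ := hc.admissible st.sampler (st.seconds ++ [x.2]) (fun τ hτ => by
          rcases List.mem_append.1 hτ with hτ | hτ
          · exact h.seconds τ hτ
          · rw [List.mem_singleton.1 hτ]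
            exact hx'.snd) opt hopt
        by_cases hbad : RegretEvent M πref β V R α ℓ samp πstar
            ((st.advance samp sel x y opt).seq πstar) (n + 1)
        · rw [Set.indicator_of_notMem (by simpa using hbad)]
          exact zero_le
        · rw [Set.indicator_of_mem (by simpa using hbad)]
          have := one_le_of_not_regretEvent hreg hsel hα hℓ h x y
            (by simp [h1, h.seconds_length]) h2 hbad
          simpa only [likProcess_advance_congr x y opt [] h] using this
    _ = ENNReal.ofReal (Real.exp (-(2 * ℓ))) * ∑ π ∈ Pol,
          (eexpect (run M πref samp sel draw n) (fun st =>
            eexpect (M.pairLaw st.cur st.sampler) fun x =>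
              eexpect (M.preference x.1 x.2) fun y =>
                likProcess M πref β V R samp πstar π (st.advance samp sel x y [])) +
          eexpect (run M πref samp sel draw n) (fun st =>
            eexpect (M.pairLaw st.cur st.sampler) fun x =>
              eexpect (draw st.sampler (st.seconds ++ [x.2]))
                (optDeviation M πref β V R πstar π l st.sampler))) := by
        simp only [eexpect_const_mul, eexpect_sum, eexpect_add, eexpect_const]
    _ ≤ ENNReal.ofReal (Real.exp (-(2 * ℓ))) * ∑ π ∈ Pol, (1 + 1) := by
        gcongr with π hπ
        · refine le_trans (eexpect_mono fun st hst => ?_)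
            (eexpect_run_likProcess_le hreg hsel hπ n (draw := draw) (samp := samp))
          exact eexpect_likProcess_advance_le hreg hπ
            (reached_of_mem_support_run hreg.mem hsel n st hst) []
        · exact hc.deviation n π hπ l
    _ = _ := by
        rw [Finset.sum_const, nsmul_eq_mul, one_add_one_eq_two, mul_comm (Pol.card : ℝ≥0∞)]

lemma toOuterMeasure_exists_not_regretEvent_le (hreg : Regular M πref Pol β V R πstar)
    (hsel : IsArgmin πref Pol β α sel) (hc : Concentrates M πref Pol β V R πstar samp sel draw)
    {ℓ : ℝ} (hα : 0 < α) (hℓ : 0 < ℓ) (k : ℕ) :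
    (run M πref samp sel draw k).toOuterMeasure
      {st | ∃ n, 1 ≤ n ∧ n ≤ k ∧
        ¬ RegretEvent M πref β V R α ℓ samp πstar (st.seq πstar) n} ≤
      k * (ENNReal.ofReal (Real.exp (-(2 * ℓ))) * (2 * Pol.card)) := by
  induction k with
  | zero =>
    have : {st : State S A | ∃ n, 1 ≤ n ∧ n ≤ 0 ∧
        ¬ RegretEvent M πref β V R α ℓ samp πstar (st.seq πstar) n} = ∅ := by
      ext st
      simp only [Set.mem_ofPred_eq, Set.mem_empty_iff_false, iff_false]
      rintro ⟨n, h1, h2, -⟩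
      omega
    rw [this]
    simp
  | succ k ih =>
    set E : ℕ → Set (State S A) := fun k => {st | ∃ n, 1 ≤ n ∧ n ≤ k ∧
        ¬ RegretEvent M πref β V R α ℓ samp πstar (st.seq πstar) n} with hE
    have hsub : E (k + 1) ⊆ E k ∪
        {st | ¬ RegretEvent M πref β V R α ℓ samp πstar (st.seq πstar) (k + 1)} := by
      rintro st ⟨n, h1, h2, h3⟩
      rcases Nat.lt_or_ge k n with h | h
      · obtain rfl : n = k + 1 := by omega
        exact Or.inr h3
      · exact Or.inl ⟨n, h1, h, h3⟩
    have hprev : (run M πref samp sel draw (k + 1)).toOuterMeasure (E k) ≤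
        (run M πref samp sel draw k).toOuterMeasure (E k) := by
      rw [toOuterMeasure_eq_eexpect, toOuterMeasure_eq_eexpect, run, eexpect_bind]
      refine eexpect_mono fun st hst => ?_
      have h := reached_of_mem_support_run hreg.mem hsel k st hst
      rw [eexpect_step]
      refine eexpect_le_const fun x _ => eexpect_le_const fun y _ => eexpect_le_const fun opt _ => ?_
      -- Events up to index `k` involve only policies already fixed in `st`.
      have hiff : st.advance samp sel x y opt ∈ E k ↔ st ∈ E k := by
        simp only [hE, Set.mem_ofPred_eq]
        refine exists_congr fun n => and_congr_right fun _ => and_congr_right fun hn => not_congr ?_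
        refine regretEvent_congr fun i hi => State.seq_advance_of_le ?_
        rw [h.past_length]
        omega
      by_cases hmem : st ∈ E k
      · rw [Set.indicator_of_mem hmem, Set.indicator_of_mem (hiff.2 hmem)]
      · rw [Set.indicator_of_notMem (mt hiff.1 hmem)]
        exact zero_le
    calc _ ≤ (run M πref samp sel draw (k + 1)).toOuterMeasure (E k ∪
          {st | ¬ RegretEvent M πref β V R α ℓ samp πstar (st.seq πstar) (k + 1)}) :=
          MeasureTheory.measure_mono hsub
      _ ≤ _ := MeasureTheory.measure_union_le _ _
      _ ≤ k * (ENNReal.ofReal (Real.exp (-(2 * ℓ))) * (2 * Pol.card)) +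
            ENNReal.ofReal (Real.exp (-(2 * ℓ))) * (2 * Pol.card) :=
          add_le_add (hprev.trans ih) (toOuterMeasure_not_regretEvent_le hreg hsel hc hα hℓ k)
      _ = _ := by
          push_cast
          ring

/-- With probability at least `1 - δ`, the regret bound holds at every iteration. -/
lemma toOuterMeasure_run_le (hreg : Regular M πref Pol β V R πstar)
    (hsel : IsArgmin πref Pol β α sel) (hc : Concentrates M πref Pol β V R πstar samp sel draw)
    {δ : ℝ} {T : ℕ} (hα : 0 < α) (hδ : 0 < δ) (hT : 1 ≤ T)
    (hℓ : Real.log 2 ≤ logTerm Pol.card T δ) :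
    (run M πref samp sel draw T).toOuterMeasure
      {st | ∃ n, 1 ≤ n ∧ n ≤ T ∧
        ¬ RegretEvent M πref β V R α (logTerm Pol.card T δ) samp πstar (st.seq πstar) n} ≤
      ENNReal.ofReal δ := by
  have hcard : 0 < Pol.card := Finset.card_pos.2 ⟨πstar, hreg.mem⟩
  have hlog2 := Real.log_pos one_lt_two
  refine (toOuterMeasure_exists_not_regretEvent_le hreg hsel hc hα (hlog2.trans_le hℓ) T).trans ?_
  have e : (T : ℝ≥0∞) * (ENNReal.ofReal (Real.exp (-(2 * logTerm Pol.card T δ))) * (2 * Pol.card)) =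
      ENNReal.ofReal (T * (Real.exp (-(2 * logTerm Pol.card T δ)) * (2 * Pol.card))) := by
    rw [ENNReal.ofReal_mul (by positivity), ENNReal.ofReal_mul (by positivity),
      ENNReal.ofReal_mul (by positivity), ENNReal.ofReal_natCast, ENNReal.ofReal_natCast]
    simp
  rw [e]
  refine ENNReal.ofReal_le_ofReal ?_
  have hc0 : (0 : ℝ) < Pol.card := by exact_mod_cast hcard
  have hT0 : (0 : ℝ) < T := by exact_mod_cast hT
  have h1 : Real.exp (-logTerm Pol.card T δ) = δ / (Pol.card * T) := by
    rw [Real.exp_neg, logTerm, Real.exp_log (by positivity)]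
    field_simp
  -- The threshold `2ℓ` provides a spare factor `exp (-ℓ) ≤ 1/2`, which absorbs the factor two from
  -- the two families of processes.
  have h2 : Real.exp (-logTerm Pol.card T δ) ≤ 1 / 2 := by
    calc _ ≤ Real.exp (-Real.log 2) := Real.exp_le_exp.2 (neg_le_neg hℓ)
      _ = 1 / 2 := by rw [Real.exp_neg, Real.exp_log two_pos, one_div]
  rw [two_mul, neg_add, Real.exp_add]
  calc _ ≤ T * (1 / 2 * (δ / (Pol.card * T)) * (2 * Pol.card)) := by
        gcongr
        exact h1.le
    _ = δ := by field_simp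

end Run

end Concentration

section Summation

/-! ### Summing the regret bounds -/

lemma sum_inv_sqrt_le (T : ℕ) : ∑ n ∈ Finset.Icc 1 T, 1 / √(n : ℝ) ≤ 2 * √(T : ℝ) := by
  induction T with
  | zero => simp
  | succ T ih =>
    rw [Finset.sum_Icc_succ_top (by omega)]
    set a := √(T : ℝ) with ha
    set b := √((T + 1 : ℕ) : ℝ) with hb
    have ha2 : a ^ 2 = T := Real.sq_sqrt (Nat.cast_nonneg T)
    have hb2 : b ^ 2 = T + 1 := by
      rw [hb, Real.sq_sqrt (Nat.cast_nonneg _)]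
      push_cast
      rfl
    have hb0 : 0 < b := Real.sqrt_pos.2 (by positivity)
    have h1 : 1 / b ≤ 2 * b - 2 * a := by
      rw [div_le_iff₀ hb0]
      nlinarith [sq_nonneg (b - a)]
    linarith

lemma sum_inv_le (T : ℕ) : ∑ n ∈ Finset.Icc 1 T, 1 / (n : ℝ) ≤ 1 + Real.log T := by
  have h := harmonic_le_one_add_log T
  rw [harmonic_eq_sum_Icc] at h
  push_cast at h
  simpa using h

lemma le_add_of_sq_le_mul {e t b η : ℝ} (hη : 0 < η) (ht : 0 ≤ t) (hb : 0 ≤ b)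
    (h : e ^ 2 ≤ t * b) : e ≤ η / 4 * t + b / η := by
  refine le_of_sq_le_sq ?_ (by positivity)
  refine h.trans ?_
  have e1 : t * b = 4 * (η / 4 * t) * (b / η) := by field_simp
  rw [e1]
  nlinarith [sq_nonneg (η / 4 * t - b / η)]

/-- The regret after one iteration, with the discrepancy bounded through its SEC term. -/
lemma gap_le_of_sq_le {g e t Q α β V R ℓ : ℝ} {n : ℕ} (hn : 1 ≤ n) (hα : 0 < α) (hβ : 0 < β)
    (hR : 0 < R) (hW : 1 ≤ V + R) (hℓ : 1 / 72 ≤ ℓ) (ht : 0 ≤ t) (hQ : 0 ≤ Q)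
    (he : e ^ 2 ≤ t * (Q + 4 * (V + R) ^ 2))
    (hg : g ≤ e + β / (α * n) * (4 * ℓ - 2 * (Q / infoConst V R)) + 4 * (V + R) * √(ℓ / n)) :
    g ≤ α * infoConst V R / (8 * β) * (n * t) + 5 * (β * ℓ / α) * (1 / n) +
      4 * (V + R) * √ℓ * (1 / √n) := by
  have hn0 : (0 : ℝ) < n := by exact_mod_cast hn
  have hK := infoConst_pos hW
  have hK2 : 576 * (V + R) ^ 2 ≤ infoConst V R := by
    unfold infoConst
    exact le_mul_of_one_le_right (by positivity) (Real.one_le_exp (by linarith))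
  set K := infoConst V R with hKdef
  -- With this AM–GM weight, `Q/η` equals the subtracted term `β/(αn) · 2Q/K`.
  have hη : 0 < α * n * K / (2 * β) := by positivity
  have h1 := le_add_of_sq_le_mul hη ht (by positivity) he
  have h2 : (Q + 4 * (V + R) ^ 2) / (α * n * K / (2 * β)) =
      β / (α * n) * (2 * (Q / K)) + β / (α * n) * (8 * (V + R) ^ 2 / K) := by
    field_simp
    ring
  -- Here `8/576 = 1/72`, which is the lower bound assumed on `ℓ`.
  have h3 : 8 * (V + R) ^ 2 / K ≤ ℓ := by
    refine le_trans ?_ hℓ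
    rw [div_le_iff₀ hK]
    linarith
  have h4 : β / (α * n) * (8 * (V + R) ^ 2 / K) ≤ β / (α * n) * ℓ := by gcongr
  have h5 : √(ℓ / n) = √ℓ * (1 / √n) := by
    rw [Real.sqrt_div' _ hn0.le]
    ring
  have h6 : α * n * K / (2 * β) / 4 * t = α * K / (8 * β) * (n * t) := by
    field_simp
    ring
  have h7 : 5 * (β * ℓ / α) * (1 / n) = β / (α * n) * (5 * ℓ) := by
    field_simp
  rw [h2, h6] at h1
  rw [h5] at hg
  rw [h7]
  linarith

/-- The constant of the regret bound. -/
def rateConst (c : ℝ) : ℝ := 216 * c + 30 / c + 24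

lemma rateConst_pos {c : ℝ} (hc : 0 < c) : 0 < rateConst c := by
  unfold rateConst
  positivity

lemma rate_nonneg {V R : ℝ} (hW : 1 ≤ V + R) (card T : ℕ) (δ sec : ℝ) :
    0 ≤ rate V R card T δ sec := by
  have : 0 < V + R := by linarith
  unfold rate
  positivity

/-- The prescribed `α` turns both `α`-dependent terms into multiples of `(V+R) T q sec`, up to `c`
and `exp (2R)`, where `q` is its square root factor and `q sec` is at most the root in the rate. The
maximum with `1` in the rate pays for the `√(ℓ/T)` term. -/
lemma le_rate_of_sum_bound {c g β V R δ sec : ℝ} {card T : ℕ} (hc : 0 < c) (hβ : 0 < β)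
    (hR : 0 < R) (hW : 1 ≤ V + R) (hT : 3 ≤ T) (hsec : 0 < sec) (hℓ : 0 < logTerm card T δ)
    (h : T / 3 * g ≤ alphaParam c β V R card T δ sec * infoConst V R / (8 * β) * (T * sec) +
      5 * (β * logTerm card T δ / alphaParam c β V R card T δ sec) * (2 * Real.log T) +
      4 * (V + R) * √(logTerm card T δ) * (2 * √T)) :
    g ≤ rateConst c * rate V R card T δ sec := by
  set ℓ := logTerm card T δ with hℓdef
  set L := Real.log T with hL
  set W := V + R with hWdef
  set E := Real.exp (2 * R) with hE
  have hW0 : 0 < W := by linarith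
  have hE1 : 1 ≤ E := Real.one_le_exp (by linarith)
  have hE0 : 0 < E := Real.exp_pos _
  have hT0 : (0 : ℝ) < T := by positivity
  have hL0 : 0 < L := Real.log_pos (by exact_mod_cast (by omega : 1 < T))
  set q := √(ℓ * L / (T * sec)) with hq
  have hq0 : 0 < q := Real.sqrt_pos.2 (by positivity)
  have hq2 : q ^ 2 * (T * sec) = ℓ * L := by
    rw [hq, Real.sq_sqrt (by positivity)]
    field_simp
  have hα : alphaParam c β V R card T δ sec = c * (β / (W * E)) * q := rfl
  set m := √(max (sec * L) 1 * ℓ / T) with hm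
  have hy : q * sec ≤ m := by
    refine Real.le_sqrt_of_sq_le ?_
    have e : (q * sec) ^ 2 = sec * L * ℓ / T := by
      rw [eq_div_iff hT0.ne']
      linear_combination sec * hq2
    rw [e]
    gcongr
    exact le_max_left _ _
  have hm1 : √ℓ * √T ≤ T * m := by
    have e : √ℓ * √T = T * √(ℓ / T) := by
      rw [Real.sqrt_div hℓ.le]
      have := Real.sq_sqrt hT0.le
      have h0 : √(T : ℝ) ≠ 0 := (Real.sqrt_pos.2 hT0).ne'
      field_simp
      rw [this]
    rw [e]
    gcongr
    refine Real.sqrt_le_sqrt ?_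
    gcongr
    exact le_mul_of_one_le_left hℓ.le (le_max_right _ _)
  have t1 : c * (β / (W * E)) * q * infoConst V R / (8 * β) * (T * sec) =
      72 * c * W * T * (q * sec) := by
    rw [infoConst, ← hWdef, ← hE]
    field_simp
    ring
  have t2 : 5 * (β * ℓ / (c * (β / (W * E)) * q)) * (2 * L) = 10 / c * W * E * T * (q * sec) := by
    have e : β * ℓ / (c * (β / (W * E)) * q) * L = W * E / c * (ℓ * L / q) := by field_simp
    have e2 : ℓ * L / q = T * (q * sec) := by
      rw [← hq2]
      field_simp
    calc _ = 10 * (β * ℓ / (c * (β / (W * E)) * q) * L) := by ring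
      _ = _ := by rw [e, e2]; ring
  rw [hα, t1, t2] at h
  have hm0 : 0 ≤ m := Real.sqrt_nonneg _
  have b1 : 72 * c * W * T * (q * sec) ≤ 72 * c * W * T * (E * m) :=
    mul_le_mul_of_nonneg_left (hy.trans (le_mul_of_one_le_left hm0 hE1)) (by positivity)
  have b2 : 10 / c * W * E * T * (q * sec) ≤ 10 / c * W * E * T * m := by gcongr
  have b3 : 4 * W * √ℓ * (2 * √T) ≤ 8 * W * (T * (E * m)) := by
    calc _ = 8 * W * (√ℓ * √T) := by ring
      _ ≤ 8 * W * (T * (E * m)) := by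
        refine mul_le_mul_of_nonneg_left (hm1.trans ?_) (by positivity)
        exact mul_le_mul_of_nonneg_left (le_mul_of_one_le_left hm0 hE1) hT0.le
  -- `rateConst c` is `3 (72 c + 10/c + 8)`; the three comes from averaging over at least `T/3`
  -- iterations.
  have hfin : T / 3 * g ≤ T / 3 * (rateConst c * rate V R card T δ sec) := by
    have e : rate V R card T δ sec = W * E * m := rfl
    rw [e, rateConst]
    refine (h.trans (add_le_add (add_le_add b1 b2) b3)).trans_eq ?_
    ring
  exact le_of_mul_le_mul_left hfin (by positivity)

/-- Summing the bounds of the individual iterations. -/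
lemma gap_le_rate {c g β V R δ sec : ℝ} {card T : ℕ} (hc : 0 < c) (hβ : 0 < β)
    (hR : 0 < R) (hW : 1 ≤ V + R) (hT : 3 ≤ T) (hsec : 0 < sec)
    (hℓ : Real.log 2 ≤ logTerm card T δ) {I : Finset ℕ} (hI : I ⊆ Finset.Icc 1 T)
    (hcard : T ≤ 3 * I.card) {t e Q : ℕ → ℝ} (ht : ∀ n ∈ I, 0 ≤ t n) (hsum : ∑ n ∈ I, t n ≤ sec)
    (hQ : ∀ n ∈ I, 0 ≤ Q n) (he : ∀ n ∈ I, e n ^ 2 ≤ t n * (Q n + 4 * (V + R) ^ 2))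
    (hg : ∀ n ∈ I, g ≤ e n + β / (alphaParam c β V R card T δ sec * n) *
      (4 * logTerm card T δ - 2 * (Q n / infoConst V R)) +
      4 * (V + R) * √(logTerm card T δ / n)) :
    g ≤ rateConst c * rate V R card T δ sec := by
  -- Positivity of `g` is needed to replace the size of `I` by `T/3`.
  rcases le_or_gt g 0 with hg0 | hg0
  · exact hg0.trans (mul_nonneg (rateConst_pos hc).le (rate_nonneg hW _ _ _ _))
  have hlog2 := Real.log_two_gt_d9
  have hℓ0 : 0 < logTerm card T δ := by linarith
  have hT0 : (0 : ℝ) < T := by positivity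
  have hL0 : 0 < Real.log T := Real.log_pos (by exact_mod_cast (by omega : 1 < T))
  -- Since `T ≥ 3 > e`, the harmonic bound `1 + log T` is at most `2 log T`.
  have hL1 : 1 ≤ Real.log T := by
    rw [Real.le_log_iff_exp_le hT0]
    have : (3 : ℝ) ≤ T := by exact_mod_cast hT
    linarith [Real.exp_one_lt_d9]
  have hW0 : 0 < V + R := by linarith
  have hα : 0 < alphaParam c β V R card T δ sec := by
    have : 0 < √(logTerm card T δ * Real.log T / (T * sec)) := Real.sqrt_pos.2 (by positivity)
    unfold alphaParam
    positivity
  have hK := infoConst_pos hW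
  refine le_rate_of_sum_bound hc hβ hR hW hT hsec hℓ0 ?_
  set α := alphaParam c β V R card T δ sec
  set ℓ := logTerm card T δ
  have hn1 : ∀ n ∈ I, 1 ≤ n ∧ n ≤ T := fun n hn => Finset.mem_Icc.1 (hI hn)
  have h1 : ∀ n ∈ I, g ≤ α * infoConst V R / (8 * β) * (T * t n) + 5 * (β * ℓ / α) * (1 / n) +
      4 * (V + R) * √ℓ * (1 / √n) := by
    intro n hn
    refine (gap_le_of_sq_le (hn1 n hn).1 hα hβ hR hW (by linarith) (ht n hn) (hQ n hn) (he n hn)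
      (hg n hn)).trans ?_
    have := ht n hn
    have : (n : ℝ) ≤ T := by exact_mod_cast (hn1 n hn).2
    gcongr
  have h2 := Finset.sum_le_sum h1
  rw [Finset.sum_const, nsmul_eq_mul, Finset.sum_add_distrib, Finset.sum_add_distrib,
    ← Finset.mul_sum, ← Finset.mul_sum, ← Finset.mul_sum, ← Finset.mul_sum] at h2
  have s1 : ∑ n ∈ I, 1 / (n : ℝ) ≤ 2 * Real.log T :=
    (Finset.sum_le_sum_of_subset_of_nonneg hI fun n _ _ => by positivity).trans
      ((sum_inv_le T).trans (by linarith))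
  have s2 : ∑ n ∈ I, 1 / √(n : ℝ) ≤ 2 * √T :=
    (Finset.sum_le_sum_of_subset_of_nonneg hI fun n _ _ => by positivity).trans
      (sum_inv_sqrt_le T)
  have hcard' : (T : ℝ) / 3 ≤ I.card := by
    have : (T : ℝ) ≤ 3 * I.card := by exact_mod_cast hcard
    linarith
  calc (T : ℝ) / 3 * g ≤ I.card * g := by gcongr
    _ ≤ _ := h2
    _ ≤ _ := by gcongr

/-- Since `ℓ/T ≥ (log 2)/2 ≥ 1/9`, the square root is at least `1/3`, and the summand `24` of
`rateConst` suffices. -/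
lemma le_rate_of_le_two {c V R δ sec : ℝ} {card T : ℕ} (hc : 0 < c) (hR : 0 < R)
    (hW : 1 ≤ V + R) (hT1 : 1 ≤ T) (hT : T ≤ 2) (hℓ : Real.log 2 ≤ logTerm card T δ) :
    V + R ≤ rateConst c * rate V R card T δ sec := by
  have hlog2 := Real.log_two_gt_d9
  have hW0 : 0 < V + R := by linarith
  have hT0 : (0 : ℝ) < T := by exact_mod_cast hT1
  have hT2 : (T : ℝ) ≤ 2 := by exact_mod_cast hT
  have h1 : 1 / 3 ≤ √(max (sec * Real.log T) 1 * logTerm card T δ / T) := by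
    refine Real.le_sqrt_of_sq_le ?_
    rw [le_div_iff₀ hT0]
    have : logTerm card T δ ≤ max (sec * Real.log T) 1 * logTerm card T δ :=
      le_mul_of_one_le_left (by linarith) (le_max_right _ _)
    linarith
  have h2 : 24 ≤ rateConst c := by
    have : 0 < 216 * c + 30 / c := by positivity
    unfold rateConst
    linarith
  have hE1 : 1 ≤ Real.exp (2 * R) := Real.one_le_exp (by linarith)
  calc V + R ≤ 24 * ((V + R) * 1 * (1 / 3)) := by linarith
    _ ≤ _ := by
      unfold rate
      gcongr


end Summation

section Main

variable {S A : Type*} {H : ℕ} {M : DCMDP S A H} {πref πstar : Policy S A}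
  {Pol : Finset (Policy S A)} {samp : Strategy S A} {sel : Selector S A}
  {draw : MixedPolicy S A → List (Traj S A) → PMF (List (Traj S A))} {β V R δ : ℝ} {T : ℕ}

/-! ### The Sequential Extrapolation Coefficient along the algorithm -/

lemma sub_one_mul_muExpect (M : DCMDP S A H) (samp : Strategy S A) (p : ℕ → Policy S A) {t : ℕ}
    (ht : 1 ≤ t) (f : Traj S A × Traj S A → ℝ) :
    ((t : ℝ) - 1) * M.muExpect samp p t f =
      ∑ i ∈ Finset.Ico 1 t, expect (M.pairLaw (p i) (DCMDP.tilde samp p i)) f := by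
  rw [DCMDP.muExpect]
  rcases eq_or_lt_of_le ht with rfl | ht
  · simp
  · have : (t : ℝ) - 1 ≠ 0 := by
      have : (1 : ℝ) < t := by exact_mod_cast ht
      linarith
    rw [← mul_assoc, mul_inv_cancel₀ this, one_mul]

lemma secTerm_nonneg (p : ℕ → Policy S A) (t : ℕ) :
    0 ≤ M.secTerm πref β V samp p t :=
  div_nonneg (sq_nonneg _) ((sq_nonneg V).trans (le_max_left _ _))

lemma sum_secTerm_le_SEC (hsec : 0 < M.SEC πref Pol T β V samp) {p : ℕ → Policy S A}
    (hp : ∀ t, p t ∈ Pol) :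
    ∑ t ∈ Finset.Icc 1 T, M.secTerm πref β V samp p t ≤ M.SEC πref Pol T β V samp := by
  refine le_ciSup (f := fun p : {p : ℕ → Policy S A // ∀ t, p t ∈ Pol} =>
    ∑ t ∈ Finset.Icc 1 T, M.secTerm πref β V samp p.1 t) ?_ ⟨p, hp⟩
  -- A real supremum over an unbounded family is `0` by convention, so positivity of the SEC forces
  -- boundedness.
  by_contra h
  rw [DCMDP.SEC, Real.iSup_of_not_bddAbove h] at hsec
  exact lt_irrefl _ hsec

/-- Any `B` above both parts of the SEC denominator may replace it, which leaves room for mismatches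
between the SEC history and the actual samplers. -/
lemma sq_expect_le_secTerm_mul (hreg : Regular M πref Pol β V R πstar) {p : ℕ → Policy S A}
    {t : ℕ} (ht : 1 ≤ t) (hp : p t ∈ Pol) {B : ℝ}
    (hB : ∑ i ∈ Finset.Ico 1 t, expect (M.pairLaw (p i) (DCMDP.tilde samp p i))
      (fun x => M.discrepancy πref β (p t) x ^ 2) ≤ B) (hVB : V ^ 2 ≤ B) :
    expect (M.pairLaw (p t) (DCMDP.tilde samp p (t - 1))) (M.discrepancy πref β (p t)) ^ 2 ≤
      M.secTerm πref β V samp p t * B := by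
  have hV := hreg.ratio.nonneg hreg.beta_pos hreg.mem
  rcases hV.eq_or_lt with rfl | hV0
  · rw [expect_congr (g := fun _ => 0) fun x hx =>
      DCMDP.discrepancy_eq_zero_of_ratio_eq_zero hreg.beta_pos hreg.ratio hp hreg.mem hreg.disc
        (M.admissiblePair_of_mem_support_pairLaw hx), expect_const]
    simpa using mul_nonneg (secTerm_nonneg p t) ((sq_nonneg _).trans hVB)
  · rw [DCMDP.secTerm, sub_one_mul_muExpect M samp p ht]
    have hpos : 0 < max (V ^ 2) (∑ i ∈ Finset.Ico 1 t,
        expect (M.pairLaw (p i) (DCMDP.tilde samp p i))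
          (fun x => M.discrepancy πref β (p t) x ^ 2)) := lt_max_of_lt_left (by positivity)
    rw [div_mul_eq_mul_div, le_div_iff₀ hpos]
    gcongr
    exact max_le hVB hB

lemma Regular.sq_le (hreg : Regular M πref Pol β V R πstar) : V ^ 2 ≤ 4 * (V + R) ^ 2 := by
  have hV := hreg.ratio.nonneg hreg.beta_pos hreg.mem
  nlinarith [hreg.R_pos]

lemma cumSq_nonneg (p : ℕ → Policy S A) (n : ℕ) (π : Policy S A) :
    0 ≤ cumSq M πref β samp p n π :=
  Finset.sum_nonneg fun _ _ => expect_nonneg fun _ _ => sq_nonneg _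

/-- The regrets of a constant fraction of the policies `p n` are controlled by terms whose sum is
at most `sec`. -/
def Controlled (M : DCMDP S A H) (πref : Policy S A) (β V R : ℝ) (samp : Strategy S A) (T : ℕ)
    (sec : ℝ) (p : ℕ → Policy S A) : Prop :=
  ∃ I ⊆ Finset.Icc 1 T, T ≤ 3 * I.card ∧ ∃ t : ℕ → ℝ, (∀ n ∈ I, 0 ≤ t n) ∧ ∑ n ∈ I, t n ≤ sec ∧
    ∀ n ∈ I, expect (M.pairLaw (p n) (sampSeq πref samp p n)) (M.discrepancy πref β (p n)) ^ 2 ≤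
      t n * (cumSq M πref β samp p n (p n) + 4 * (V + R) ^ 2)

/-- The SEC counts from one and its first policy is `πref = p 0`, hence the shift `p' t = p (t -
1)`: the term at `n + 1` concerns `p n` and the sampler available when it is chosen. -/
lemma controlled_general (hreg : Regular M πref Pol β V R πstar)
    (hsec : 0 < M.SEC πref Pol T β V samp) (hT : 3 ≤ T) {p : ℕ → Policy S A}
    (hp : ∀ n, p n ∈ Pol) :
    Controlled M πref β V R samp T (M.SEC πref Pol T β V samp) p := by
  have hV := hreg.ratio.nonneg hreg.beta_pos hreg.mem
  set p' : ℕ → Policy S A := fun t => p (t - 1) with hp'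
  have htilde : ∀ n, 2 ≤ n → DCMDP.tilde samp p' n = sampSeq πref samp p n := by
    intro n hn
    rw [sampSeq, if_neg (by omega), DCMDP.tilde]
    rfl
  -- Index `1` is dropped because its sampler is `πref` and not `samp [πref]`, and `T` because `n +
  -- 1 ≤ T` is required. The remaining `T - 2` indices are at least a third of `T`.
  refine ⟨Finset.Icc 2 (T - 1), Finset.Icc_subset_Icc (by omega) (by omega), by simp; omega,
    fun n => M.secTerm πref β V samp p' (n + 1), fun n _ => secTerm_nonneg _ _, ?_, ?_⟩
  · refine le_trans ?_ (sum_secTerm_le_SEC hsec (p := p') fun t => hp _)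
    have e : ∑ n ∈ Finset.Icc 2 (T - 1), M.secTerm πref β V samp p' (n + 1) =
        ∑ t ∈ (Finset.Icc 2 (T - 1)).map (addRightEmbedding 1), M.secTerm πref β V samp p' t := by
      rw [Finset.sum_map]
      rfl
    rw [e]
    refine Finset.sum_le_sum_of_subset_of_nonneg ?_ fun t _ _ => secTerm_nonneg _ _
    intro t ht
    simp only [Finset.mem_map, Finset.mem_Icc, addRightEmbedding_apply] at ht ⊢
    omega
  · intro n hn
    have hn2 : 2 ≤ n := (Finset.mem_Icc.1 hn).1
    have hsq := hreg.sq_le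
    have h0 := cumSq_nonneg (M := M) (πref := πref) (β := β) (samp := samp) p n (p n)
    have h := sq_expect_le_secTerm_mul (samp := samp) hreg (p := p') (t := n + 1) (by omega) (hp _)
      (B := cumSq M πref β samp p n (p n) + 4 * (V + R) ^ 2) ?_ (by linarith)
    · rw [Nat.add_sub_cancel, htilde n hn2] at h
      exact h
    · obtain ⟨k, rfl⟩ : ∃ k, n = k + 1 := ⟨n - 1, by omega⟩
      rw [Finset.sum_Ico_eq_sum_range, Nat.add_sub_cancel, cumSq, Finset.sum_range_succ',
        Finset.sum_range_succ' _ k, add_assoc (Finset.sum _ _)]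
      refine add_le_add (le_of_eq (Finset.sum_congr rfl fun i _ => ?_)) ?_
      · rw [htilde _ (by omega), add_comm 1 (i + 1)]
        rfl
      -- The first history terms use different samplers, `samp [πref]` in the SEC and `πref` in the
      -- run. The SEC one is bounded crudely by `4(V+R)²`.
      · have h1 := DCMDP.expect_discrepancy_sq_le hreg.beta_pos hreg.R_pos hreg.ret hreg.ratio
          (hp (k + 1)) (p' (1 + 0)) (DCMDP.tilde samp p' (1 + 0))
        have h2 : 0 ≤ expect (M.pairLaw (p 0) (sampSeq πref samp p (0 + 1)))
          fun x => M.discrepancy πref β (p (k + 1)) x ^ 2 := expect_nonneg fun _ _ => sq_nonneg _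
        exact h1.trans (le_add_of_nonneg_left h2)

/-- A constant sampler needs no index shift: deleting `p 0 = πref` from the history only shrinks the
sum, so all `T` iterations serve and the initial policy may lie outside the class. The value of `p'`
at `0` is padding. -/
lemma controlled_ref (hreg : Regular M πref Pol β V R πstar)
    (hsec : 0 < M.SEC πref Pol T β V (refStrategy πref)) {p : ℕ → Policy S A}
    (hp : ∀ n, 1 ≤ n → p n ∈ Pol) :
    Controlled M πref β V R (refStrategy πref) T (M.SEC πref Pol T β V (refStrategy πref)) p := by
  have hV := hreg.ratio.nonneg hreg.beta_pos hreg.mem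
  set p' : ℕ → Policy S A := fun t => p (max t 1) with hp'
  have hp1 : ∀ n, 1 ≤ n → p' n = p n := fun n hn => by simp [hp', hn]
  have htilde : ∀ n, DCMDP.tilde (refStrategy πref) p' n = PMF.pure πref := fun n => rfl
  refine ⟨Finset.Icc 1 T, subset_rfl, by simp; omega,
    M.secTerm πref β V (refStrategy πref) p', fun n _ => secTerm_nonneg _ _,
    sum_secTerm_le_SEC hsec fun t => hp _ (le_max_right _ _), ?_⟩
  intro n hn
  have hn1 : 1 ≤ n := (Finset.mem_Icc.1 hn).1
  have hsq := hreg.sq_le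
  have h0 := cumSq_nonneg (M := M) (πref := πref) (β := β) (samp := refStrategy πref) p n (p n)
  have h := sq_expect_le_secTerm_mul (samp := refStrategy πref) hreg (p := p') (t := n) hn1
    (hp _ (le_max_right _ _))
    (B := cumSq M πref β (refStrategy πref) p n (p n) + 4 * (V + R) ^ 2) ?_ (by linarith)
  · rw [htilde, hp1 n hn1] at h
    rw [sampSeq_refStrategy]
    exact h
  · refine le_trans ?_ (le_add_of_nonneg_right (by positivity))
    rw [cumSq, Finset.range_eq_Ico, hp1 n hn1]
    calc _ = ∑ i ∈ Finset.Ico 1 n, expect (M.pairLaw (p i)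
          (sampSeq πref (refStrategy πref) p (i + 1)))
            fun x => M.discrepancy πref β (p n) x ^ 2 := by
          refine Finset.sum_congr rfl fun i hi => ?_
          rw [htilde, sampSeq_refStrategy, hp1 i (Finset.mem_Ico.1 hi).1]
      _ ≤ _ := Finset.sum_le_sum_of_subset_of_nonneg
          (Finset.Ico_subset_Ico (Nat.zero_le _) le_rfl)
          fun _ _ _ => expect_nonneg fun _ _ => sq_nonneg _

/-! ### The main theorem -/

lemma State.seq_mem_policies {d : Policy S A} {st : State S A} {n : ℕ} (hn : n ≤ st.past.length) :
    st.seq d n ∈ st.policies := by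
  rw [State.policies_eq_map_seq (d := d)]
  exact List.mem_map.2 ⟨n, List.mem_range.2 (by omega), rfl⟩

lemma log_two_le_logTerm {card : ℕ} (hδ0 : 0 < δ) (hδ1 : δ < 1) (h : 2 ≤ card * T) :
    Real.log 2 ≤ logTerm card T δ := by
  refine Real.log_le_log two_pos ?_
  have h1 : (2 : ℝ) ≤ card * T := by exact_mod_cast h
  have h2 : 1 ≤ δ⁻¹ := (one_le_inv₀ hδ0).2 hδ1.le
  exact h1.trans (le_mul_of_one_le_right (by linarith) h2)

/-- The regret bound for any variant of the algorithm whose optimism data concentrates. -/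
theorem one_sub_le_toOuterMeasure_run {c sec : ℝ} (hc : 0 < c)
    (hreg : Regular M πref Pol β V R πstar) (hδ0 : 0 < δ) (hδ1 : δ < 1) (hT : 1 ≤ T)
    (hsec : 0 < sec) (hsel : IsArgmin πref Pol β (alphaParam c β V R Pol.card T δ sec) sel)
    (hconc : Concentrates M πref Pol β V R πstar samp sel draw)
    (hctrl : 3 ≤ T → ∀ p : ℕ → Policy S A, p 0 = πref → (∀ n, 1 ≤ n → p n ∈ Pol) →
      Controlled M πref β V R samp T sec p) :
    ENNReal.ofReal (1 - δ) ≤ (run M πref samp sel draw T).toOuterMeasure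
      {st | ∀ πhat, IsOutput M πref β st πhat →
        M.J πref β πstar - M.J πref β πhat ≤ rateConst c * rate V R Pol.card T δ sec} := by
  have hW0 : 0 < V + R := by linarith [hreg.one_le]
  have hcard : 0 < Pol.card := Finset.card_pos.2 ⟨πstar, hreg.mem⟩
  have hreached := fun st => reached_of_mem_support_run (M := M) (πref := πref) (samp := samp)
    (draw := draw) hreg.mem hsel T st
  have hout : ∀ st ∈ (run M πref samp sel draw T).support, ∀ πhat, IsOutput M πref β st πhat →
      ∀ n ≤ T, M.J πref β (st.seq πstar n) ≤ M.J πref β πhat := by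
    intro st hst πhat h n hn
    refine h.2 _ (State.seq_mem_policies ?_)
    rwa [(hreached st hst).past_length]
  rcases Nat.lt_or_ge T 3 with hT3 | hT3
  · refine one_sub_le_toOuterMeasure (t := ∅) hδ0.le (fun st hst _ πhat h => ?_) (by simp)
    -- With one policy `ℓ` may be too small for the crude bound, but then the first chosen policy is
    -- `πstar`. Otherwise `|Π| T ≥ 2` and comparison with `πref` suffices.
    by_cases hone : Pol.card = 1
    · obtain ⟨q, hq⟩ := Finset.card_eq_one.1 hone
      have h1 := (hreached st hst).seq_mem 1 le_rfl
      have h2 := hreg.mem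
      rw [hq, Finset.mem_singleton] at h1 h2
      have h3 := hout st hst πhat h 1 hT
      rw [h1, ← h2] at h3
      exact (sub_nonpos.2 h3).trans
        (mul_nonneg (rateConst_pos hc).le (rate_nonneg hreg.one_le _ _ _ _))
    · have h3 := hout st hst πhat h 0 (Nat.zero_le _)
      rw [(hreached st hst).seq_zero] at h3
      have h4 := DCMDP.J_sub_J_ref_le hreg.beta_pos hreg.ret hreg.ratio hreg.mem hreg.disc
      have h5 := le_rate_of_le_two (sec := sec) hc hreg.R_pos hreg.one_le hT (by omega)
        (log_two_le_logTerm hδ0 hδ1 (by nlinarith [show 2 ≤ Pol.card by omega]) :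
          Real.log 2 ≤ logTerm Pol.card T δ)
      linarith
  · have hℓ : Real.log 2 ≤ logTerm Pol.card T δ := log_two_le_logTerm hδ0 hδ1 (by nlinarith)
    have hℓ0 : 0 < logTerm Pol.card T δ := (Real.log_pos one_lt_two).trans_le hℓ
    have hα : 0 < alphaParam c β V R Pol.card T δ sec := by
      have hL0 : 0 < Real.log T := Real.log_pos (by exact_mod_cast (by omega : 1 < T))
      have hT0 : (0 : ℝ) < T := by exact_mod_cast hT
      have hβ := hreg.beta_pos
      have : 0 < √(logTerm Pol.card T δ * Real.log T / (T * sec)) := Real.sqrt_pos.2 (by positivity)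
      unfold alphaParam
      positivity
    refine one_sub_le_toOuterMeasure hδ0.le (fun st hst hgood πhat h => ?_)
      (toOuterMeasure_run_le hreg hsel hconc hα hδ0 hT hℓ)
    have hr := hreached st hst
    obtain ⟨I, hI, hIcard, t, ht, hsum, hE⟩ := hctrl hT3 (st.seq πstar) hr.seq_zero hr.seq_mem
    refine gap_le_rate hc hreg.beta_pos hreg.R_pos hreg.one_le hT3 hsec hℓ hI hIcard ht hsum
      (fun n _ => cumSq_nonneg _ _ _) hE fun n hn => ?_
    have hn1 := Finset.mem_Icc.1 (hI hn)
    have hev : RegretEvent M πref β V R (alphaParam c β V R Pol.card T δ sec)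
        (logTerm Pol.card T δ) samp πstar (st.seq πstar) n := by
      by_contra hc'
      exact hgood ⟨n, hn1.1, hn1.2, hc'⟩
    exact (sub_le_sub_left (hout st hst πhat h n hn1.2) _).trans hev


end Main

end XPO

end

open XPO in
theorem mainTheorem2 :
    ∀ c : ℝ, 0 < c → ∃ C : ℝ, 0 < C ∧
      ∀ (S : Type*) (A : Type*) (H : ℕ) (M : DCMDP S A H) (πref : Policy S A)
        (Pol : Finset (Policy S A)) (β V R δ : ℝ) (T : ℕ) (πstar : Policy S A),
        0 < β → 0 < R → 1 ≤ V + R → 0 < δ → δ < 1 → 1 ≤ T →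
        M.BoundedReturn R →
        M.IsOptimal πref β πstar → πstar ∈ Pol →
        M.BoundedRatio πref Pol β V →
        -- general sampling strategy
        (∀ samp : Strategy S A, πref ∈ Pol →
          0 < M.SEC πref Pol T β V samp →
          ∀ sel : Selector S A,
            IsArgmin πref Pol β
              (alphaParam c β V R Pol.card T δ (M.SEC πref Pol T β V samp)) sel →
            ENNReal.ofReal (1 - δ) ≤ (runGeneral M πref samp sel T).toOuterMeasure
              {st | ∀ πhat, IsOutput M πref β st πhat →
                M.J πref β πstar - M.J πref β πhat ≤
                  C * rate V R Pol.card T δ (M.SEC πref Pol T β V samp)}) ∧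
        -- sampling from the reference policy
        (0 < M.SEC πref Pol T β V (refStrategy πref) →
          ∀ sel : Selector S A,
            IsArgmin πref Pol β
              (alphaParam c β V R Pol.card T δ (M.SEC πref Pol T β V (refStrategy πref))) sel →
            ENNReal.ofReal (1 - δ) ≤ (runXPO M πref sel T).toOuterMeasure
              {st | ∀ πhat, IsOutput M πref β st πhat →
                M.J πref β πstar - M.J πref β πhat ≤
                  C * rate V R Pol.card T δ (M.SEC πref Pol T β V (refStrategy πref))}) := by
  intro c hc
  refine ⟨rateConst c, rateConst_pos hc, ?_⟩
  intro S A H M πref Pol β V R δ T πstar hβ hR0 hW hδ0 hδ1 hT hR hopt hstar hV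
  have hreg : Regular M πref Pol β V R πstar :=
    ⟨hβ, hR0, hW, hR, hV, hstar, hopt.discrepancy_eq_zero hβ hR hV hstar⟩
  constructor
  · intro samp href hsec sel hsel
    refine one_sub_le_toOuterMeasure_run hc hreg hδ0 hδ1 hT hsec hsel (concentrates_iid hreg)
      fun hT3 p hp0 hp => controlled_general hreg hsec hT3 fun n => ?_
    -- The shifted SEC sequence starts at `πref`, which must therefore belong to the class.
    rcases Nat.eq_zero_or_pos n with rfl | hn
    · rwa [hp0]
    · exact hp n hn
  · intro hsec sel hsel
    exact one_sub_le_toOuterMeasure_run hc hreg hδ0 hδ1 hT hsec hsel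
      (concentrates_seconds hreg hsel) fun _ p _ hp => controlled_ref hreg hsec hp
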